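/- Work in the language of groups (a binary operation symbol, a symbol for the inverse and a constant for the identity). A structure whose universe is a set of natural numbers is computable if its atomic diagram $D(\mathcal{B})$ (the set of Gödel numbers of the atomic sentences and negated atomic sentences, with constants for the elements of $\mathcal{B}$, that are true in $\mathcal{B}$) is computable. Finitary quantifier-free formulas are both computable $\Sigma_0$ and computable $\Pi_0$; for $n>0$, a formula is computable $\Sigma_n$ (respectively computable $\Pi_n$) if it is a disjunction (respectively conjunction) over a computably enumerable set of formulas $(\exists\bar y)\,\psi$ (respectively $(\forall\bar y)\,\psi$), where each $\psi$ is computable $\Pi_m$ (respectively computable $\Sigma_m$) for some $m<n$, and the formulas are given by their indices. A Scott sentence for a countable structure $\mathcal{A}$ is a sentence of $L_{\omega_1\omega}$ whose countable models are exactly the isomorphic copies of $\mathcal{A}$. The index set $I(\mathcal{A})$ is the set of all $e\in\mathbb{N}$ such that the partial computable function $\varphi_e$ is the characteristic function of $D(\mathcal{B})$ for some $\mathcal{B}\cong\mathcal{A}$ with universe contained in $\mathbb{N}$. Let $G$ be a subgroup of the additive group $\mathbb{Q}$ that is isomorphic to a computable structure. Fix a nonzero element $u\in G$ (playing the role of $1$),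 and write $G\models m\mid u$ if $u=my$ for some $y\in G$. Let $$P^0=\{p \text{ prime}: G\models p\nmid u\},$$ $$P^{fin}=\{p\text{ prime}: G\models p^k\mid u \text{ and } G\models p^{k+1}\nmid u\text{ for some }k>0\},$$ $$P^\infty=\{p\text{ prime}: G\models p^k\mid u\text{ for all }k>0\}.$$ Suppose that $P^0$ and $P^\infty$ are finite and $P^{fin}$ is infinite. Then $G$ has a Scott sentence that is computable $\Sigma_3$, and $I(G)$ is $m$-complete $\Sigma^0_3$; that is, $I(G)$ is $\Sigma^0_3$ and every $\Sigma^0_3$ set $T\subseteq\mathbb{N}$ is many-one reducible to $I(G)$. -/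

import Mathlib

namespace InfGroup

/-! ## The language of groups

A structure for the language of groups (a binary operation symbol, a unary operation symbol and a
constant symbol) is a type `M` with `[Mul M] [Inv M] [One M]`; no laws are imposed. -/

/-- `M` and `N` are isomorphic as structures for the language of groups. -/
def StructIso (M N : Type) [Mul M] [Inv M] [One M] [Mul N] [Inv N] [One N] : Prop :=
  ∃ f : M ≃ N, (∀ a b, f (a * b) = f a * f b) ∧ (∀ a, f a⁻¹ = (f a)⁻¹) ∧ f 1 = 1

/-- Terms of the language of groups. The symbols `var n` are variables in formulas, and constants
naming the elements `n` of the universe in atomic diagrams. -/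
inductive GTerm : Type
  | one : GTerm
  | var : ℕ → GTerm
  | inv : GTerm → GTerm
  | mul : GTerm → GTerm → GTerm

namespace GTerm

/-- The set of symbols `var n` that occur in a term. -/
def vars : GTerm → Set ℕ
  | one => ∅
  | var n => {n}
  | inv t => t.vars
  | mul s t => s.vars ∪ t.vars

/-- The value of a term in a structure, under an assignment. -/
def value {M : Type} [Mul M] [Inv M] [One M] (v : ℕ → M) : GTerm → M
  | one => 1
  | var n => v n
  | inv t => (t.value v)⁻¹
  | mul s t => s.value v * t.value v

/-- Gödel numbers of terms. -/
def toNat : GTerm → ℕ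
  | one => 0
  | var n => 3 * n + 1
  | inv t => 3 * t.toNat + 2
  | mul s t => 3 * Nat.pair s.toNat t.toNat + 3

/-- The term with a given Gödel number. -/
def ofNat : ℕ → GTerm
  | 0 => one
  | n + 1 =>
    have h : n / 3 < n + 1 := by omega
    have _h1 : (n / 3).unpair.1 < n + 1 := lt_of_le_of_lt (Nat.unpair_left_le _) h
    have _h2 : (n / 3).unpair.2 < n + 1 := lt_of_le_of_lt (Nat.unpair_right_le _) h
    if n % 3 = 0 then var (n / 3)
    else if n % 3 = 1 then inv (ofNat (n / 3))
    else mul (ofNat (n / 3).unpair.1) (ofNat (n / 3).unpair.2)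

theorem ofNat_toNat (t : GTerm) : ofNat t.toNat = t := by
  induction t with
  | one => simp [toNat, ofNat]
  | var n =>
    have h1 : (3 * n) % 3 = 0 := by omega
    have h2 : (3 * n) / 3 = n := by omega
    simp [toNat, ofNat]
  | inv t ih =>
    have h1 : (3 * t.toNat + 1) % 3 = 1 := by omega
    have h2 : (3 * t.toNat + 1) / 3 = t.toNat := by omega
    simp [toNat, ofNat, h1, h2, ih]
  | mul s t ihs iht =>
    have h1 : (3 * Nat.pair s.toNat t.toNat + 2) % 3 = 2 := by omega
    have h2 : (3 * Nat.pair s.toNat t.toNat + 2) / 3 = Nat.pair s.toNat t.toNat := by omega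
    simp [toNat, ofNat, h1, h2, ihs, iht]

theorem toNat_ofNat (n : ℕ) : (ofNat n).toNat = n := by
  induction n using Nat.strong_induction_on with
  | _ n ih =>
    cases n with
    | zero => simp [ofNat, toNat]
    | succ n =>
      have h : n / 3 < n + 1 := by omega
      have h1 : (n / 3).unpair.1 < n + 1 := lt_of_le_of_lt (Nat.unpair_left_le _) h
      have h2 : (n / 3).unpair.2 < n + 1 := lt_of_le_of_lt (Nat.unpair_right_le _) h
      rw [ofNat]
      split_ifs with c1 c2
      · simp only [toNat]; omega
      · simp only [toNat, ih _ h]; omega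
      · simp only [toNat, ih _ h1, ih _ h2, Nat.pair_unpair]; omega

instance : Denumerable GTerm :=
  Denumerable.mk' ⟨toNat, ofNat, ofNat_toNat, toNat_ofNat⟩

end GTerm

/-- Finitary quantifier-free formulas in the language of groups, in negation normal form. -/
inductive QFFormula : Type
  | eq : GTerm → GTerm → QFFormula
  | ne : GTerm → GTerm → QFFormula
  | conj : QFFormula → QFFormula → QFFormula
  | disj : QFFormula → QFFormula → QFFormula

namespace QFFormula

/-- The set of symbols `var n` that occur in a quantifier-free formula. -/
def vars : QFFormula → Set ℕ
  | eq s t => s.vars ∪ t.vars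
  | ne s t => s.vars ∪ t.vars
  | conj φ ψ => φ.vars ∪ ψ.vars
  | disj φ ψ => φ.vars ∪ ψ.vars

/-- Satisfaction of a quantifier-free formula under an assignment. -/
def Holds {M : Type} [Mul M] [Inv M] [One M] (v : ℕ → M) : QFFormula → Prop
  | eq s t => s.value v = t.value v
  | ne s t => s.value v ≠ t.value v
  | conj φ ψ => φ.Holds v ∧ ψ.Holds v
  | disj φ ψ => φ.Holds v ∨ ψ.Holds v

/-- Atomic formulas and negations of atomic formulas. -/
def IsLiteral : QFFormula → Prop
  | eq _ _ => True
  | ne _ _ => True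
  | conj _ _ => False
  | disj _ _ => False

/-- Gödel numbers of quantifier-free formulas. -/
def toNat : QFFormula → ℕ
  | eq s t => 4 * Nat.pair s.toNat t.toNat
  | ne s t => 4 * Nat.pair s.toNat t.toNat + 1
  | conj φ ψ => 4 * Nat.pair φ.toNat ψ.toNat + 2
  | disj φ ψ => 4 * Nat.pair φ.toNat ψ.toNat + 3

/-- The quantifier-free formula with a given Gödel number. -/
def ofNat (n : ℕ) : QFFormula :=
  if n % 4 = 0 then eq (GTerm.ofNat (n / 4).unpair.1) (GTerm.ofNat (n / 4).unpair.2)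
  else if n % 4 = 1 then ne (GTerm.ofNat (n / 4).unpair.1) (GTerm.ofNat (n / 4).unpair.2)
  else if n % 4 = 2 then conj (ofNat (n / 4).unpair.1) (ofNat (n / 4).unpair.2)
  else disj (ofNat (n / 4).unpair.1) (ofNat (n / 4).unpair.2)
termination_by n
decreasing_by
  all_goals
    have h : n / 4 < n := by omega
    first
      | exact lt_of_le_of_lt (Nat.unpair_left_le _) h
      | exact lt_of_le_of_lt (Nat.unpair_right_le _) h

theorem ofNat_toNat (φ : QFFormula) : ofNat φ.toNat = φ := by
  induction φ with
  | eq s t =>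
    rw [toNat, ofNat]
    simp [GTerm.ofNat_toNat]
  | ne s t =>
    have h1 : (4 * Nat.pair s.toNat t.toNat + 1) % 4 = 1 := by omega
    have h2 : (4 * Nat.pair s.toNat t.toNat + 1) / 4 = Nat.pair s.toNat t.toNat := by omega
    rw [toNat, ofNat]
    simp [h1, h2, GTerm.ofNat_toNat]
  | conj φ ψ ih1 ih2 =>
    have h1 : (4 * Nat.pair φ.toNat ψ.toNat + 2) % 4 = 2 := by omega
    have h2 : (4 * Nat.pair φ.toNat ψ.toNat + 2) / 4 = Nat.pair φ.toNat ψ.toNat := by omega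
    rw [toNat, ofNat]
    simp [h1, h2, ih1, ih2]
  | disj φ ψ ih1 ih2 =>
    have h1 : (4 * Nat.pair φ.toNat ψ.toNat + 3) % 4 = 3 := by omega
    have h2 : (4 * Nat.pair φ.toNat ψ.toNat + 3) / 4 = Nat.pair φ.toNat ψ.toNat := by omega
    rw [toNat, ofNat]
    simp [h1, h2, ih1, ih2]

theorem toNat_ofNat (n : ℕ) : (ofNat n).toNat = n := by
  induction n using Nat.strong_induction_on with
  | _ n ih =>
    rw [ofNat]
    split_ifs with c0 c1 c2
    · simp only [toNat, GTerm.toNat_ofNat, Nat.pair_unpair]; omega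
    · simp only [toNat, GTerm.toNat_ofNat, Nat.pair_unpair]; omega
    all_goals
      have h : n / 4 < n := by omega
      have h1 : (n / 4).unpair.1 < n := lt_of_le_of_lt (Nat.unpair_left_le _) h
      have h2 : (n / 4).unpair.2 < n := lt_of_le_of_lt (Nat.unpair_right_le _) h
      simp only [toNat, ih _ h1, ih _ h2, Nat.pair_unpair]
      omega

instance : Denumerable QFFormula :=
  Denumerable.mk' ⟨toNat, ofNat, ofNat_toNat, toNat_ofNat⟩

end QFFormula

/-! ## Computable infinitary formulas -/

/-- Formulas of `L_{ω₁ω}` in negation normal form, for the language of groups: countable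
disjunctions and conjunctions, and finite blocks of existential and universal quantifiers. -/
inductive InfFormula : Type
  | qf : QFFormula → InfFormula
  | bigOr (I : Set ℕ) : (I → InfFormula) → InfFormula
  | bigAnd (I : Set ℕ) : (I → InfFormula) → InfFormula
  | exs : List ℕ → InfFormula → InfFormula
  | alls : List ℕ → InfFormula → InfFormula

namespace InfFormula

/-- The set of free variables of a formula. -/
def freeVars : InfFormula → Set ℕ
  | qf θ => θ.vars
  | bigOr _ φ => ⋃ i, (φ i).freeVars
  | bigAnd _ φ => ⋃ i, (φ i).freeVars
  | exs xs φ => φ.freeVars \ {x | x ∈ xs}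
  | alls xs φ => φ.freeVars \ {x | x ∈ xs}

/-- A sentence is a formula without free variables. -/
def IsSentence (φ : InfFormula) : Prop := φ.freeVars = ∅

/-- Satisfaction of a formula under an assignment. -/
def Holds {M : Type} [Mul M] [Inv M] [One M] : InfFormula → (ℕ → M) → Prop
  | qf θ, v => θ.Holds v
  | bigOr _ φ, v => ∃ i, (φ i).Holds v
  | bigAnd _ φ, v => ∀ i, (φ i).Holds v
  | exs xs φ, v => ∃ w : ℕ → M, (∀ x, x ∉ xs → w x = v x) ∧ φ.Holds w
  | alls xs φ, v => ∀ w : ℕ → M, (∀ x, x ∉ xs → w x = v x) → φ.Holds w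

/-- `M` is a model of `φ`. -/
def Models (M : Type) [Mul M] [Inv M] [One M] (φ : InfFormula) : Prop :=
  ∀ v : ℕ → M, φ.Holds v

end InfFormula

/-- The partial computable function with index `e`. -/
def phi (e : ℕ) : ℕ →. ℕ := (Denumerable.ofNat Nat.Partrec.Code e).eval

/-- The `e`-th computably enumerable set, the domain of `phi e`. -/
def W (e : ℕ) : Set ℕ := {n | (phi e n).Dom}

/-- The components `(m, xs, i)` of a number that codes a disjunct or conjunct: the level `m` and
the index `i` of a formula, and the block `xs` of variables quantified in front of it. -/
def member (c : ℕ) : ℕ × List ℕ × ℕ := Denumerable.ofNat (ℕ × List ℕ × ℕ) c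

mutual

/-- The computable `Σ_n` formula with index `e`. For `n = 0` it is the finitary quantifier-free
formula with Gödel number `e`; for `n + 1` it is the disjunction, over the c.e. set of all codes
`(m, xs, i)` in `W e` with `m ≤ n`, of `∃ xs ψ`, where `ψ` is the computable `Π_m` formula with
index `i`. -/
def sigmaFormula (n e : ℕ) : InfFormula :=
  match n with
  | 0 => InfFormula.qf (Denumerable.ofNat QFFormula e)
  | n + 1 => InfFormula.bigOr {c | c ∈ W e ∧ (member c).1 ≤ n} fun c =>
      have _h : (member c.1).1 < n + 1 := Nat.lt_succ_of_le c.2.2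
      InfFormula.exs (member c.1).2.1 (piFormula (member c.1).1 (member c.1).2.2)
termination_by n

/-- The computable `Π_n` formula with index `e`, defined dually. -/
def piFormula (n e : ℕ) : InfFormula :=
  match n with
  | 0 => InfFormula.qf (Denumerable.ofNat QFFormula e)
  | n + 1 => InfFormula.bigAnd {c | c ∈ W e ∧ (member c).1 ≤ n} fun c =>
      have _h : (member c.1).1 < n + 1 := Nat.lt_succ_of_le c.2.2
      InfFormula.alls (member c.1).2.1 (sigmaFormula (member c.1).1 (member c.1).2.2)
termination_by n

end

/-- `φ` is a computable `Σ_n` formula. -/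
def IsComputableSigma (n : ℕ) (φ : InfFormula) : Prop := ∃ e, φ = sigmaFormula n e

/-- `φ` is a Scott sentence for `A`: the countable models of the sentence `φ` are exactly the
isomorphic copies of `A`. -/
def IsScottSentence (φ : InfFormula) (A : Type) [Mul A] [Inv A] [One A] : Prop :=
  φ.IsSentence ∧
    ∀ (M : Type) [Mul M] [Inv M] [One M] [Countable M], φ.Models M ↔ StructIso M A

/-! ## Computable structures and index sets -/

/-- A structure for the language of groups whose universe is a set of natural numbers. -/
structure NatStructure where
  carrier : Set ℕ
  op : carrier → carrier → carrier
  inverse : carrier → carrier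
  unit : carrier

namespace NatStructure

instance (B : NatStructure) : Mul B.carrier := ⟨B.op⟩
instance (B : NatStructure) : Inv B.carrier := ⟨B.inverse⟩
instance (B : NatStructure) : One B.carrier := ⟨B.unit⟩

/-- The atomic diagram of `B`, as a set of Gödel numbers: the atomic sentences and negations of
atomic sentences, with constants for elements of `B`, that are true in `B` when `var b` names `b`.
-/
def atomicDiagram (B : NatStructure) : Set ℕ :=
  {n | (QFFormula.ofNat n).IsLiteral ∧ (QFFormula.ofNat n).vars ⊆ B.carrier ∧
    ∀ v : ℕ → B.carrier, (∀ b : B.carrier, v b = b) → (QFFormula.ofNat n).Holds v}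

/-- A structure is computable if its atomic diagram is computable. -/
def IsComputable (B : NatStructure) : Prop := ComputablePred fun n => n ∈ B.atomicDiagram

end NatStructure

/-- `A` is isomorphic to a computable structure. -/
def IsComputablyPresented (A : Type) [Mul A] [Inv A] [One A] : Prop :=
  ∃ B : NatStructure, B.IsComputable ∧ StructIso B.carrier A

open Classical in
/-- The index set of `A`: all `e` such that the `e`-th partial computable function is the
characteristic function of the atomic diagram of some structure isomorphic to `A`. -/
def indexSet (A : Type) [Mul A] [Inv A] [One A] : Set ℕ :=
  {e | ∃ B : NatStructure, StructIso B.carrier A ∧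
    ∀ n, phi e n = Part.some (if n ∈ B.atomicDiagram then 1 else 0)}

/-! ## `Σ⁰₃` sets -/

/-- `S` is `Σ⁰₃`. -/
def IsSigma03 (S : Set ℕ) : Prop :=
  ∃ R : ℕ × ℕ × ℕ × ℕ → Prop, ComputablePred R ∧ ∀ n, n ∈ S ↔ ∃ x, ∀ y, ∃ z, R (n, x, y, z)

/-- `S` is `m`-complete `Σ⁰₃`. -/
def IsMCompleteSigma03 (S : Set ℕ) : Prop :=
  IsSigma03 S ∧ ∀ T : Set ℕ, IsSigma03 T → ManyOneReducible (fun n => n ∈ T) (fun n => n ∈ S)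

/-! ## Subgroups of `ℚ` -/

/-- `G ⊨ m ∣ u`: the element `u` is `m` times an element of `G`. -/
def DividesIn (G : AddSubgroup ℚ) (m : ℕ) (u : ℚ) : Prop := ∃ y ∈ G, m • y = u

/-- The primes that do not divide `u` in `G`. -/
def primesZero (G : AddSubgroup ℚ) (u : ℚ) : Set ℕ := {p | p.Prime ∧ ¬ DividesIn G p u}

/-- The primes that divide `u` in `G`, but only to a finite power. -/
def primesFin (G : AddSubgroup ℚ) (u : ℚ) : Set ℕ :=
  {p | p.Prime ∧ ∃ k > 0, DividesIn G (p ^ k) u ∧ ¬ DividesIn G (p ^ (k + 1)) u}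

/-- The primes all of whose powers divide `u` in `G`. -/
def primesInf (G : AddSubgroup ℚ) (u : ℚ) : Set ℕ :=
  {p | p.Prime ∧ ∀ k > 0, DividesIn G (p ^ k) u}

end InfGroup

-- A subgroup of `ℚ` containing `u ≠ 0` is determined by the set `S` of all `k` that divide `u` in
-- it: if `x = (a/d)u` is in lowest terms, Bézout puts `u/d` into the group, so `x` lies in the
-- group exactly when `d ∈ S`. Hence a structure is isomorphic to `G` iff it is a torsion-free
-- abelian group with a nontrivial element `x` on which every element depends and whose set of
-- divisors is `S` (`structIso_iff_isRankOne`). As `G` has a computable copy, `S` is c.e.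
-- (`sig1_dividesIn`), and the conditions on `x` are then `Π₂`: the laws are universal, dependence
-- is `∀∃`, and "`k` divides `x` iff `k ∈ S`" is an equivalence of two `Σ₁` statements. Putting `∃
-- x` in front gives the Scott sentence (`exists_sigma3_isRankOne`). The same count, together with a
-- `Π⁰₂` description of which indices compute atomic diagrams (`pi2_isDiagram`,
-- `IsDiagram.exists_structure`), shows that the index set is `Σ⁰₃`.
--
-- For hardness, a `Σ⁰₃` set `T` yields computable functions `c n` such that `n ∈ T` iff `c n` takes
-- some value infinitely often (`exists_limit_function`), which happens iff the co-c.e. set of true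
-- stages `i`, those with `c n i < c n s` for all `s > i`, is finite (`finite_trueStages_iff`). Let
-- `Q n` be the set of primes dividing `u` whose index is a true stage, and `H n` the intersection
-- of `G` with all `p • G`, `p ∈ Q n`. If `Q n` is finite, then `H n = N • G ≅ G`, where `N` is the
-- product of `Q n` (`structIso_divisibleBy`). If it is infinite, then, since all but finitely many
-- primes divide `u` to a finite positive power, the exponent drops at infinitely many primes and `H
-- n` is not isomorphic to `G` (`not_structIso_divisibleBy`).
--
-- The groups `H n` have uniformly computable copies although `Q n` is only co-c.e. A prime of `Q n`
-- that does not divide `d` divides `(a/d)u` automatically, because it divides `u`; so membership in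
-- `H n` needs only the finitely many primes dividing `d`, and for each of them one waits for `p ∉ Q
-- n` or for a quotient by `p` (`mem_divisibleBy_iff`, `sig1_mem_divisibleBy`). Uniformly c.e.
-- subgroups of a computable group have uniformly computable copies (`exists_uniform_presentation`).

attribute [fun_prop] Computable ComputablePred
attribute [fun_prop] Computable.comp Computable.pair Computable.const

/-! ## Computable functions -/

section Computable

variable {α β γ : Type} [Primcodable α] [Primcodable β] [Primcodable γ]

@[fun_prop]
theorem computable_id : Computable (fun x : α => x) := Computable.id

@[fun_prop]
theorem Computable.fst_comp {f : α → β × γ} (hf : Computable f) : Computable (fun x => (f x).1) :=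
  Computable.fst.comp hf

@[fun_prop]
theorem Computable.snd_comp {f : α → β × γ} (hf : Computable f) : Computable (fun x => (f x).2) :=
  Computable.snd.comp hf

@[fun_prop]
theorem Computable.add {f g : α → ℕ} (hf : Computable f) (hg : Computable g) :
    Computable (fun x => f x + g x) := Primrec.nat_add.to_comp.comp hf hg

@[fun_prop]
theorem Computable.sub {f g : α → ℕ} (hf : Computable f) (hg : Computable g) :
    Computable (fun x => f x - g x) := Primrec.nat_sub.to_comp.comp hf hg

@[fun_prop]
theorem Computable.mul {f g : α → ℕ} (hf : Computable f) (hg : Computable g) :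
    Computable (fun x => f x * g x) := Primrec.nat_mul.to_comp.comp hf hg

@[fun_prop]
theorem Computable.div {f g : α → ℕ} (hf : Computable f) (hg : Computable g) :
    Computable (fun x => f x / g x) := Primrec.nat_div.to_comp.comp hf hg

@[fun_prop]
theorem Computable.mod {f g : α → ℕ} (hf : Computable f) (hg : Computable g) :
    Computable (fun x => f x % g x) := Primrec.nat_mod.to_comp.comp hf hg

@[fun_prop]
theorem Computable.natPair {f g : α → ℕ} (hf : Computable f) (hg : Computable g) :
    Computable (fun x => Nat.pair (f x) (g x)) := Primrec₂.natPair.to_comp.comp hf hg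

@[fun_prop]
theorem Computable.natUnpair {f : α → ℕ} (hf : Computable f) :
    Computable (fun x => (f x).unpair) := Computable.unpair.comp hf

@[fun_prop]
theorem Computable.encode_comp {f : α → β} (hf : Computable f) :
    Computable (fun x => Encodable.encode (f x)) := Computable.encode.comp hf

@[fun_prop]
theorem Computable.ofNat_comp {β : Type} [Denumerable β] {f : α → ℕ} (hf : Computable f) :
    Computable (fun x => Denumerable.ofNat β (f x)) := (Computable.ofNat β).comp hf

@[fun_prop]
theorem Computable.some_comp {f : α → β} (hf : Computable f) :
    Computable (fun x => Option.some (f x)) := Computable.option_some.comp hf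

@[fun_prop]
theorem Computable.getElem?_comp {l : α → List β} {f : α → ℕ} (hl : Computable l)
    (hf : Computable f) : Computable (fun x => (l x)[f x]?) :=
  Computable.list_getElem?.comp hl hf

@[fun_prop]
theorem Computable.length_comp {l : α → List β} (hl : Computable l) :
    Computable (fun x => (l x).length) :=
  Computable.list_length.comp hl

theorem Computable.ite_comp {p : α → Prop} [DecidablePred p] {f g : α → β}
    (hp : ComputablePred p) (hf : Computable f) (hg : Computable g) :
    Computable (fun x => if p x then f x else g x) :=
  (Computable.cond hp.decide hf hg).of_eq fun x => by by_cases h : p x <;> simp [h]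

end Computable

/-! ## Computable predicates -/

section ComputablePred

variable {α β : Type} [Primcodable α] [Primcodable β]

theorem ComputablePred.comp {p : β → Prop} {f : α → β} (hp : ComputablePred p)
    (hf : Computable f) : ComputablePred (fun a => p (f a)) := by
  obtain ⟨_, hp⟩ := hp
  exact ⟨fun a => inferInstance, hp.comp hf⟩

@[fun_prop]
theorem ComputablePred.not' {p : α → Prop} (hp : ComputablePred p) :
    ComputablePred (fun a => ¬ p a) := hp.not

@[fun_prop]
theorem ComputablePred.and {p q : α → Prop} (hp : ComputablePred p) (hq : ComputablePred q) :
    ComputablePred (fun a => p a ∧ q a) := by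
  classical
  exact Computable.computablePred ((Primrec.and.to_comp.comp hp.decide hq.decide).of_eq
    fun a => by simp)

@[fun_prop]
theorem ComputablePred.or {p q : α → Prop} (hp : ComputablePred p) (hq : ComputablePred q) :
    ComputablePred (fun a => p a ∨ q a) := by
  classical
  exact Computable.computablePred ((Primrec.or.to_comp.comp hp.decide hq.decide).of_eq
    fun a => by simp)

theorem ComputablePred.imp {p q : α → Prop} (hp : ComputablePred p) (hq : ComputablePred q) :
    ComputablePred (fun a => p a → q a) :=
  (hp.not.or hq).of_eq fun a => by tauto

@[fun_prop]
theorem ComputablePred.const (p : Prop) : ComputablePred (fun _ : α => p) := by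
  classical
  exact Computable.computablePred (Computable.const _)

@[fun_prop]
theorem ComputablePred.eq {f g : α → β} (hf : Computable f) (hg : Computable g) :
    ComputablePred (fun a => f a = g a) := by
  classical
  exact ComputablePred.comp (p := fun x : β × β => x.1 = x.2) Primrec.eq.computablePred
    (hf.pair hg)

@[fun_prop]
theorem ComputablePred.le {f g : α → ℕ} (hf : Computable f) (hg : Computable g) :
    ComputablePred (fun a => f a ≤ g a) :=
  ComputablePred.comp (p := fun x : ℕ × ℕ => x.1 ≤ x.2) Primrec.nat_le.computablePred (hf.pair hg)

@[fun_prop]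
theorem ComputablePred.lt {f g : α → ℕ} (hf : Computable f) (hg : Computable g) :
    ComputablePred (fun a => f a < g a) :=
  ComputablePred.comp (p := fun x : ℕ × ℕ => x.1 < x.2) Primrec.nat_lt.computablePred (hf.pair hg)

@[fun_prop]
theorem ComputablePred.dvd {f g : α → ℕ} (hf : Computable f) (hg : Computable g) :
    ComputablePred (fun a => f a ∣ g a) :=
  (ComputablePred.eq (hg.mod hf) (Computable.const 0)).of_eq fun _ =>
    (Nat.dvd_iff_mod_eq_zero).symm

theorem ComputablePred.forall_lt {P : α → ℕ → Prop} {f : α → ℕ}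
    (hP : ComputablePred fun x : α × ℕ => P x.1 x.2) (hf : Computable f) :
    ComputablePred fun a => ∀ k < f a, P a k := by
  classical
  have h : Computable fun a : α =>
      (Nat.rec true (fun k b => b && decide (P a k)) (f a) : Bool) := by
    refine Computable.nat_rec (h := fun a x => x.2 && decide (P a x.1)) hf (Computable.const true) ?_
    refine Primrec.and.to_comp.comp (g := fun x : α × ℕ × Bool => x.2.2) (by fun_prop) ?_
    exact hP.decide.comp (g := fun p : α × ℕ × Bool => (p.1, p.2.1)) (by fun_prop)
  refine Computable.computablePred (h.of_eq fun a => ?_)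
  induction f a with
  | zero => simp
  | succ n ih =>
    simp only [ih]
    rw [Bool.eq_iff_iff]
    simp only [Bool.and_eq_true, decide_eq_true_eq, Order.lt_add_one_iff]
    constructor
    · rintro ⟨h1, h2⟩ k hk
      rcases hk.lt_or_eq with h | rfl
      exacts [h1 k h, h2]
    · exact fun h => ⟨fun k hk => h k hk.le, h n le_rfl⟩

theorem ComputablePred.exists_lt {P : α → ℕ → Prop} {f : α → ℕ}
    (hP : ComputablePred fun x : α × ℕ => P x.1 x.2) (hf : Computable f) :
    ComputablePred fun a => ∃ k < f a, P a k :=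
  (ComputablePred.forall_lt (P := fun a k => ¬ P a k) hP.not hf).not.of_eq fun a => by
    push Not; rfl

theorem computablePred_prime : ComputablePred Nat.Prime := by
  have h : ComputablePred fun p : ℕ => 2 ≤ p ∧ ∀ m < p, m ∣ p → m = 1 :=
    ComputablePred.and (by fun_prop) (ComputablePred.forall_lt (P := fun p m => m ∣ p → m = 1)
      (ComputablePred.imp (by fun_prop) (by fun_prop)) (by fun_prop))
  exact h.of_eq fun p => Nat.prime_def_lt.symm

/-- On primes this function is the index, inverse to `Nat.nth Nat.Prime`; the reduction uses it to
turn a set of stages into a set of primes. -/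
theorem computable_primeCounting' : Computable Nat.primeCounting' := by
  have h : Computable fun n : ℕ =>
      (Nat.rec 0 (fun k c => c + if k.Prime then 1 else 0) n : ℕ) := by
    refine Computable.nat_rec (f := fun n : ℕ => n) (g := fun _ : ℕ => 0)
      (h := fun _ x => x.2 + if x.1.Prime then 1 else 0) (by fun_prop) (by fun_prop) ?_
    refine Computable.add (f := fun x : ℕ × ℕ × ℕ => x.2.2) (by fun_prop) ?_
    exact Computable.ite_comp (computablePred_prime.comp (by fun_prop)) (by fun_prop)
      (by fun_prop)
  refine h.of_eq fun n => ?_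
  rw [Nat.primeCounting']
  induction n with
  | zero => simp
  | succ n ih => simp only [ih, Nat.count_succ]

end ComputablePred

namespace InfGroup

/-! ## `Σ⁰₁` and `Π⁰₂` predicates -/

/-- `P` is `Σ⁰₁`. -/
def Sig1 {α : Type} [Primcodable α] (P : α → Prop) : Prop :=
  ∃ R : α → ℕ → Prop, (ComputablePred fun x : α × ℕ => R x.1 x.2) ∧ ∀ a, P a ↔ ∃ s, R a s

/-- `P` is `Π⁰₂`. -/
def Pi2 {α : Type} [Primcodable α] (P : α → Prop) : Prop :=
  ∃ Q : α → ℕ → Prop, (Sig1 fun x : α × ℕ => Q x.1 x.2) ∧ ∀ a, P a ↔ ∀ n, Q a n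

section Sig1

variable {α β : Type} [Primcodable α] [Primcodable β]

theorem _root_.ComputablePred.sig1 {P : α → Prop} (hP : ComputablePred P) : Sig1 P :=
  ⟨fun a _ => P a, hP.comp (by fun_prop), fun a => by simp⟩

namespace Sig1

theorem of_eq {P Q : α → Prop} (hP : Sig1 P) (h : ∀ a, P a ↔ Q a) : Sig1 Q :=
  (funext fun a => propext (h a) : P = Q) ▸ hP

theorem comp {P : β → Prop} {f : α → β} (hP : Sig1 P) (hf : Computable f) :
    Sig1 (fun a => P (f a)) := by
  obtain ⟨R, hR, h⟩ := hP
  exact ⟨fun a s => R (f a) s,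
    hR.comp (f := fun x : α × ℕ => (f x.1, x.2)) (by fun_prop), fun a => h _⟩

theorem ex {γ : Type} [Denumerable γ] {P : α → γ → Prop}
    (hP : Sig1 fun x : α × γ => P x.1 x.2) : Sig1 fun a => ∃ c, P a c := by
  obtain ⟨R, hR, h⟩ := hP
  refine ⟨fun a s => R (a, Denumerable.ofNat γ s.unpair.1) s.unpair.2, hR.comp
    (f := fun x : α × ℕ => ((x.1, Denumerable.ofNat γ x.2.unpair.1), x.2.unpair.2))
    (by fun_prop), fun a => ⟨?_, ?_⟩⟩
  · rintro ⟨c, hc⟩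
    obtain ⟨s, hs⟩ := (h (a, c)).1 hc
    exact ⟨Nat.pair (Encodable.encode c) s, by simpa using hs⟩
  · rintro ⟨s, hs⟩
    exact ⟨_, (h (a, _)).2 ⟨_, hs⟩⟩

theorem or {P Q : α → Prop} (hP : Sig1 P) (hQ : Sig1 Q) : Sig1 fun a => P a ∨ Q a := by
  obtain ⟨R, hR, h⟩ := hP
  obtain ⟨R', hR', h'⟩ := hQ
  refine ⟨fun a s => R a s ∨ R' a s, hR.or hR', fun a => ?_⟩
  simp only [h, h', exists_or]

theorem and {P Q : α → Prop} (hP : Sig1 P) (hQ : Sig1 Q) : Sig1 fun a => P a ∧ Q a := by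
  obtain ⟨R, hR, h⟩ := hP
  obtain ⟨R', hR', h'⟩ := hQ
  refine ⟨fun a s => R a s.unpair.1 ∧ R' a s.unpair.2,
    (hR.comp (f := fun x : α × ℕ => (x.1, x.2.unpair.1)) (by fun_prop)).and
    (hR'.comp (f := fun x : α × ℕ => (x.1, x.2.unpair.2)) (by fun_prop)), fun a => ?_⟩
  simp only [h, h']
  constructor
  · rintro ⟨⟨s, hs⟩, t, ht⟩
    exact ⟨Nat.pair s t, by simpa using ⟨hs, ht⟩⟩
  · rintro ⟨s, hs⟩
    exact ⟨⟨_, hs.1⟩, _, hs.2⟩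

/-- Finitely many witnesses have a common strict bound, so a single unbounded search, for that
bound, is enough. -/
theorem forall_lt {P : α → ℕ → Prop} {f : α → ℕ}
    (hP : Sig1 fun x : α × ℕ => P x.1 x.2) (hf : Computable f) :
    Sig1 fun a => ∀ k < f a, P a k := by
  obtain ⟨R, hR, h⟩ := hP
  refine ⟨fun a s => ∀ k < f a, ∃ t < s, R (a, k) t, ?_, fun a => ⟨fun H => ?_, ?_⟩⟩
  · refine ComputablePred.forall_lt (P := fun (x : α × ℕ) k => ∃ t < x.2, R (x.1, k) t)
      (f := fun x : α × ℕ => f x.1) ?_ (by fun_prop)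
    refine ComputablePred.exists_lt (P := fun (x : (α × ℕ) × ℕ) t => R (x.1.1, x.2) t)
      (f := fun x : (α × ℕ) × ℕ => x.1.2) ?_ (by fun_prop)
    exact hR.comp (f := fun x : ((α × ℕ) × ℕ) × ℕ => ((x.1.1.1, x.1.2), x.2)) (by fun_prop)
  · have H' : ∀ k, ∃ t, k < f a → R (a, k) t := fun k => by
      by_cases hk : k < f a
      · obtain ⟨t, ht⟩ := (h (a, k)).1 (H k hk)
        exact ⟨t, fun _ => ht⟩
      · exact ⟨0, fun h => absurd h hk⟩
    choose t ht using H'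
    refine ⟨(Finset.range (f a)).sup t + 1, fun k hk => ⟨t k, ?_, ht k hk⟩⟩
    exact Nat.lt_succ_of_le (Finset.le_sup (Finset.mem_range.2 hk))
  · rintro ⟨s, hs⟩ k hk
    obtain ⟨t, _, ht⟩ := hs k hk
    exact (h (a, k)).2 ⟨t, ht⟩

theorem pi2 {P : α → Prop} (hP : Sig1 P) : Pi2 P :=
  ⟨fun a _ => P a, hP.comp (by fun_prop), fun a => by simp⟩

end Sig1

namespace Pi2

theorem of_eq {P Q : α → Prop} (hP : Pi2 P) (h : ∀ a, P a ↔ Q a) : Pi2 Q :=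
  (funext fun a => propext (h a) : P = Q) ▸ hP

theorem comp {P : β → Prop} {f : α → β} (hP : Pi2 P) (hf : Computable f) :
    Pi2 (fun a => P (f a)) := by
  obtain ⟨R, hR, h⟩ := hP
  exact ⟨fun a s => R (f a) s,
    hR.comp (f := fun x : α × ℕ => (f x.1, x.2)) (by fun_prop), fun a => h _⟩

theorem all {γ : Type} [Denumerable γ] {P : α → γ → Prop}
    (hP : Pi2 fun x : α × γ => P x.1 x.2) : Pi2 fun a => ∀ c, P a c := by
  obtain ⟨Q, hQ, h⟩ := hP
  refine ⟨fun a s => Q (a, Denumerable.ofNat γ s.unpair.1) s.unpair.2, hQ.comp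
    (f := fun x : α × ℕ => ((x.1, Denumerable.ofNat γ x.2.unpair.1), x.2.unpair.2))
    (by fun_prop), fun a => ⟨fun H s => (h (a, _)).1 (H _) _, fun H c => ?_⟩⟩
  refine (h (a, c)).2 fun n => ?_
  simpa using H (Nat.pair (Encodable.encode c) n)

theorem and {P Q : α → Prop} (hP : Pi2 P) (hQ : Pi2 Q) : Pi2 fun a => P a ∧ Q a := by
  obtain ⟨R, hR, h⟩ := hP
  obtain ⟨R', hR', h'⟩ := hQ
  refine ⟨fun a s => R a s ∧ R' a s, hR.and hR', fun a => ?_⟩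
  simp only [h, h', forall_and]

/-- The witness of the `Σ⁰₁` premise becomes one more universal variable, and its matrix is
computable, so the negation costs nothing. -/
theorem imp {P Q : α → Prop} (hP : Sig1 P) (hQ : Pi2 Q) : Pi2 fun a => P a → Q a := by
  obtain ⟨R, hR, h⟩ := hP
  obtain ⟨R', hR', h'⟩ := hQ
  refine ⟨fun a s => ¬ R a s.unpair.1 ∨ R' a s.unpair.2,
    (hR.not.comp (f := fun x : α × ℕ => (x.1, x.2.unpair.1)) (by fun_prop)).sig1.or
    (hR'.comp (f := fun x : α × ℕ => (x.1, x.2.unpair.2)) (by fun_prop)), fun a => ?_⟩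
  simp only [h, h']
  constructor
  · intro H s
    by_cases hs : R a s.unpair.1
    · exact Or.inr (H ⟨_, hs⟩ _)
    · exact Or.inl hs
  · rintro H ⟨s, hs⟩ n
    simpa [hs] using H (Nat.pair s n)

theorem iff {P Q : α → Prop} (hP : Sig1 P) (hQ : Sig1 Q) : Pi2 fun a => P a ↔ Q a :=
  ((imp hP hQ.pi2).and (imp hQ hP.pi2)).of_eq fun _ => iff_iff_implies_and_implies.symm

theorem isSigma03 {P : ℕ → ℕ → Prop} (hP : Pi2 fun x : ℕ × ℕ => P x.1 x.2) {S : Set ℕ}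
    (hS : ∀ n, n ∈ S ↔ ∃ x, P n x) : IsSigma03 S := by
  obtain ⟨Q, ⟨R, hR, hQ⟩, h⟩ := hP
  refine ⟨fun x => R ((x.1, x.2.1), x.2.2.1) x.2.2.2, hR.comp
    (f := fun x : ℕ × ℕ × ℕ × ℕ => (((x.1, x.2.1), x.2.2.1), x.2.2.2)) (by fun_prop),
    fun n => ?_⟩
  rw [hS]
  exact exists_congr fun x => (h (n, x)).trans (forall_congr' fun y => hQ ((n, x), y))

end Pi2

-- Indices of partial computable functions and of c.e. sets

theorem sig1_phi : Sig1 fun x : ℕ × ℕ × ℕ => x.2.2 ∈ phi x.1 x.2.1 := by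
  refine ⟨fun x s => Nat.Partrec.Code.evaln s (Denumerable.ofNat Nat.Partrec.Code x.1) x.2.1
    = some x.2.2, ?_, fun x => ?_⟩
  · refine ComputablePred.eq ?_ (by fun_prop)
    exact Nat.Partrec.Code.primrec_evaln.to_comp.comp (g := fun x : (ℕ × ℕ × ℕ) × ℕ =>
      ((x.2, Denumerable.ofNat Nat.Partrec.Code x.1.1), x.1.2.1)) (by fun_prop)
  · exact Nat.Partrec.Code.evaln_complete

/-- The s-m-n theorem: currying a code is a computable operation on codes. -/
theorem exists_index_of_partrec {γ : Type} [Denumerable γ] {g : γ × ℕ →. ℕ} (hg : Partrec g) :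
    ∃ f : γ → ℕ, Computable f ∧ ∀ a n, phi (f a) n = g (a, n) := by
  have hg' : Nat.Partrec fun n => g (Denumerable.ofNat γ n.unpair.1, n.unpair.2) :=
    Partrec.nat_iff.1 (hg.comp (g := fun n : ℕ => (Denumerable.ofNat γ n.unpair.1, n.unpair.2))
      (by fun_prop))
  obtain ⟨c, hc⟩ := Nat.Partrec.Code.exists_code.1 hg'
  refine ⟨fun a => Encodable.encode (Nat.Partrec.Code.curry c (Encodable.encode a)), ?_,
    fun a n => ?_⟩
  · exact Computable.encode.comp (Nat.Partrec.Code.primrec₂_curry.to_comp.comp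
      (g := fun _ => c) (h := fun a : γ => Encodable.encode a) (by fun_prop) (by fun_prop))
  · simp [phi, Nat.Partrec.Code.eval_curry, hc]

/-- The unbounded search for a witness halts exactly on `P`, and s-m-n makes its index depend
computably on the parameter. -/
theorem Sig1.exists_index {γ : Type} [Denumerable γ] {P : γ → ℕ → Prop}
    (hP : Sig1 fun x : γ × ℕ => P x.1 x.2) :
    ∃ f : γ → ℕ, Computable f ∧ ∀ a n, n ∈ W (f a) ↔ P a n := by
  classical
  obtain ⟨R, hR, h⟩ := hP
  have hg : Partrec fun x : γ × ℕ => Nat.rfind fun s => Part.some (decide (R x s)) :=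
    Partrec.rfind hR.decide.partrec
  obtain ⟨f, hf, hfg⟩ := exists_index_of_partrec hg
  refine ⟨f, hf, fun a n => ?_⟩
  rw [show P a n ↔ _ from h (a, n)]
  change (phi (f a) n).Dom ↔ _
  rw [hfg]
  exact Nat.rfind_dom'.trans (by simp)

open Classical in
theorem _root_.ComputablePred.exists_index {γ : Type} [Denumerable γ] {P : γ → ℕ → Prop}
    (hP : ComputablePred fun x : γ × ℕ => P x.1 x.2) :
    ∃ f : γ → ℕ, Computable f ∧ ∀ a n, phi (f a) n = Part.some (if P a n then 1 else 0) := by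
  have hg : Computable fun x : γ × ℕ => if P x.1 x.2 then 1 else 0 :=
    Computable.ite_comp hP (by fun_prop) (by fun_prop)
  exact exists_index_of_partrec hg.partrec

end Sig1

/-! ## Terms and formulas -/

section Terms

variable {α : Type} [Primcodable α]

theorem encode_term (t : GTerm) : Encodable.encode t = t.toNat := rfl

theorem ofNat_formula (n : ℕ) : Denumerable.ofNat QFFormula n = QFFormula.ofNat n := rfl

@[fun_prop]
theorem _root_.Computable.gtermVar {f : α → ℕ} (hf : Computable f) :
    Computable fun a => GTerm.var (f a) :=
  Computable.encode_iff.1 (show Computable fun a => 3 * f a + 1 by fun_prop)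

@[fun_prop]
theorem _root_.Computable.gtermInv {f : α → GTerm} (hf : Computable f) :
    Computable fun a => GTerm.inv (f a) :=
  Computable.encode_iff.1 (show Computable fun a => 3 * Encodable.encode (f a) + 2 by fun_prop)

@[fun_prop]
theorem _root_.Computable.gtermMul {f g : α → GTerm} (hf : Computable f) (hg : Computable g) :
    Computable fun a => GTerm.mul (f a) (g a) :=
  Computable.encode_iff.1 (show Computable fun a =>
    3 * Nat.pair (Encodable.encode (f a)) (Encodable.encode (g a)) + 3 by fun_prop)

@[fun_prop]
theorem _root_.Computable.qfEq {f g : α → GTerm} (hf : Computable f) (hg : Computable g) :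
    Computable fun a => QFFormula.eq (f a) (g a) :=
  Computable.encode_iff.1 (show Computable fun a =>
    4 * Nat.pair (Encodable.encode (f a)) (Encodable.encode (g a)) by fun_prop)

@[fun_prop]
theorem _root_.Computable.qfNe {f g : α → GTerm} (hf : Computable f) (hg : Computable g) :
    Computable fun a => QFFormula.ne (f a) (g a) :=
  Computable.encode_iff.1 (show Computable fun a =>
    4 * Nat.pair (Encodable.encode (f a)) (Encodable.encode (g a)) + 1 by fun_prop)

@[fun_prop]
theorem _root_.Computable.qfDisj {f g : α → QFFormula} (hf : Computable f) (hg : Computable g) :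
    Computable fun a => QFFormula.disj (f a) (g a) :=
  Computable.encode_iff.1 (show Computable fun a =>
    4 * Nat.pair (Encodable.encode (f a)) (Encodable.encode (g a)) + 3 by fun_prop)

/-- The term `t ^ k`. -/
def GTerm.pow (t : GTerm) : ℕ → GTerm
  | 0 => one
  | k + 1 => mul (t.pow k) t

@[fun_prop]
theorem _root_.Computable.gtermPow {f : α → GTerm} {g : α → ℕ} (hf : Computable f) (hg : Computable g) :
    Computable fun a => (f a).pow (g a) := by
  have h : Computable fun a => (Nat.rec GTerm.one (fun _ t => GTerm.mul t (f a)) (g a) : GTerm) :=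
    Computable.nat_rec (h := fun a x => GTerm.mul x.2 (f a)) hg (by fun_prop)
      (show Computable fun x : α × ℕ × GTerm => GTerm.mul x.2.2 (f x.1) by fun_prop)
  refine h.of_eq fun a => ?_
  induction g a with
  | zero => rfl
  | succ n ih => simp only [GTerm.pow, ih]

theorem GTerm.vars_pow_subset (t : GTerm) (k : ℕ) : (t.pow k).vars ⊆ t.vars := by
  induction k with
  | zero => simp [pow, vars]
  | succ k ih => simp [pow, vars, ih]

theorem GTerm.value_congr {M : Type} [Mul M] [Inv M] [One M] {v w : ℕ → M} (t : GTerm)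
    (h : ∀ x ∈ t.vars, v x = w x) : t.value v = t.value w := by
  induction t with
  | one => rfl
  | var n => exact h n rfl
  | inv t ih => simp only [value, ih h]
  | mul s t ihs iht =>
    simp only [value, ihs fun x hx => h x (Or.inl hx), iht fun x hx => h x (Or.inr hx)]

/-- Replace the variables of a term according to a partial map. -/
def GTerm.rename (c : ℕ → Option ℕ) : GTerm → Option GTerm
  | one => some one
  | var n => (c n).map var
  | inv t => (t.rename c).map inv
  | mul s t => (s.rename c).bind fun s' => (t.rename c).map fun t' => mul s' t'

theorem _root_.Computable.gtermRename {c : α → ℕ → Option ℕ}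
    (hc : Computable fun x : α × ℕ => c x.1 x.2) :
    Computable fun x : α × GTerm => x.2.rename (c x.1) := by
  -- Course-of-values recursion on Gödel numbers: `l` lists the results for all smaller numbers, so
  -- its length is the current number. The outer `Option` belongs to the recursion scheme, the inner
  -- one is the partiality of renaming.
  let g : α → List (Option GTerm) → Option (Option GTerm) := fun a l =>
    if l.length = 0 then some (some GTerm.one)
    else if (l.length - 1) % 3 = 0 then some ((c a ((l.length - 1) / 3)).map GTerm.var)
    else if (l.length - 1) % 3 = 1 then l[(l.length - 1) / 3]?.map fun t => t.map GTerm.inv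
    else l[((l.length - 1) / 3).unpair.1]?.bind fun s =>
      l[((l.length - 1) / 3).unpair.2]?.map fun t =>
        s.bind fun s' => t.map fun t' => GTerm.mul s' t'
  have hg : Computable₂ g := by
    refine Computable.ite_comp (by fun_prop) (by fun_prop) ?_
    refine Computable.ite_comp (by fun_prop) ?_ ?_
    · refine Computable.some_comp (Computable.option_map ?_ ?_)
      · exact hc.comp (g := fun x : α × List (Option GTerm) => (x.1, (x.2.length - 1) / 3))
          (by fun_prop)
      · exact Computable.gtermVar (f := fun x : (α × List (Option GTerm)) × ℕ => x.2)
          (by fun_prop)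
    refine Computable.ite_comp (by fun_prop) ?_ ?_
    · refine Computable.option_map (by fun_prop) ?_
      refine Computable.option_map
        (f := fun x : (α × List (Option GTerm)) × Option GTerm => x.2) (by fun_prop) ?_
      exact Computable.gtermInv
        (f := fun x : ((α × List (Option GTerm)) × Option GTerm) × GTerm => x.2) (by fun_prop)
    · refine Computable.option_bind (by fun_prop) ?_
      refine Computable.option_map
        (f := fun x : (α × List (Option GTerm)) × Option GTerm =>
          x.1.2[((x.1.2.length - 1) / 3).unpair.2]?) (by fun_prop) ?_
      refine Computable.option_bind
        (f := fun x : ((α × List (Option GTerm)) × Option GTerm) × Option GTerm => x.1.2)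
        (by fun_prop) ?_
      refine Computable.option_map
        (f := fun x : (((α × List (Option GTerm)) × Option GTerm) × Option GTerm) × GTerm =>
          x.1.2) (by fun_prop) ?_
      exact Computable.gtermMul
        (f := fun x : ((((α × List (Option GTerm)) × Option GTerm) × Option GTerm) × GTerm)
          × GTerm => x.1.2) (g := fun x => x.2) (by fun_prop) (by fun_prop)
  have h := Computable.nat_strong_rec (fun a n => (GTerm.ofNat n).rename (c a)) hg fun a n => by
    cases n with
    | zero => simp [g, GTerm.ofNat, GTerm.rename]
    | succ n =>
      have h0 : n / 3 < n + 1 := by omega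
      have h1 := lt_of_le_of_lt (Nat.unpair_left_le _) h0
      have h2 := lt_of_le_of_lt (Nat.unpair_right_le _) h0
      rw [GTerm.ofNat]
      by_cases c0 : n % 3 = 0
      · simp [g, c0, GTerm.rename]
      by_cases c1 : n % 3 = 1
      · simp [g, c1, GTerm.rename, h0]
      · simp [g, c0, c1, GTerm.rename, h1, h2]
  refine (h.comp (g := fun x : α × GTerm => x.1) (h := fun x => Encodable.encode x.2)
    (by fun_prop) (by fun_prop)).of_eq fun x => ?_
  rw [encode_term, GTerm.ofNat_toNat]

end Terms

end InfGroup

namespace InfGroup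

/-! ## Subgroups of `ℚ` and their isomorphism types -/

section StructIso

variable {M N K : Type} [Mul M] [Inv M] [One M] [Mul N] [Inv N] [One N] [Mul K] [Inv K] [One K]

theorem StructIso.symm (h : StructIso M N) : StructIso N M := by
  obtain ⟨f, hm, hi, h1⟩ := h
  refine ⟨f.symm, fun a b => ?_, fun a => ?_, ?_⟩ <;> apply f.injective <;> simp [hm, hi, h1]

theorem StructIso.trans (h : StructIso M N) (h' : StructIso N K) : StructIso M K := by
  obtain ⟨f, hm, hi, h1⟩ := h
  obtain ⟨g, hm', hi', h1'⟩ := h'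
  exact ⟨f.trans g, by simp [hm, hm'], by simp [hi, hi'], by simp [h1, h1']⟩

end StructIso

/-- `M` is a torsion-free abelian group of rank one, and `S` is the set of all `k` such that `x` is
a `k`-th power. -/
structure IsRankOne (M : Type) [Mul M] [Inv M] [One M] (x : M) (S : Set ℕ) : Prop where
  assoc : ∀ a b c : M, a * b * c = a * (b * c)
  one_mul : ∀ a : M, 1 * a = a
  inv_mul : ∀ a : M, a⁻¹ * a = 1
  comm : ∀ a b : M, a * b = b * a
  ne_one : x ≠ 1
  torsionFree : ∀ (k : ℕ) (a : M), npowRec (k + 1) a = 1 → a = 1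
  rank : ∀ a : M, ∃ k n : ℕ, npowRec (k + 1) a = npowRec n x ∨
    npowRec (k + 1) a * npowRec n x = 1
  divides : ∀ k : ℕ, (∃ a : M, npowRec k a = x) ↔ k ∈ S

/-- Powers are written with `npowRec` because it makes sense before any group law is known. -/
theorem map_npowRec {M N : Type} [Mul M] [One M] [Mul N] [One N] {f : M → N}
    (hm : ∀ a b, f (a * b) = f a * f b) (h1 : f 1 = 1) (k : ℕ) (a : M) :
    f (npowRec k a) = npowRec k (f a) := by
  induction k with
  | zero => exact h1
  | succ k ih => simp only [npowRec, hm, ih]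

theorem IsRankOne.of_structIso {M N : Type} [Mul M] [Inv M] [One M] [Mul N] [Inv N] [One N]
    (h : StructIso M N) {x : N} {S : Set ℕ} (hx : IsRankOne N x S) : ∃ y, IsRankOne M y S := by
  obtain ⟨f, hm, hi, h1⟩ := h
  have hp := map_npowRec hm h1
  obtain ⟨y, rfl⟩ := f.surjective x
  refine ⟨y, ⟨fun a b c => ?_, fun a => ?_, fun a => ?_, fun a b => ?_, ?_, fun k a h => ?_,
    fun a => ?_, fun k => ?_⟩⟩
  · apply f.injective; simp only [hm, hx.assoc]
  · apply f.injective; simp only [hm, h1, hx.one_mul]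
  · apply f.injective; simp only [hm, h1, hi, hx.inv_mul]
  · apply f.injective; simp only [hm]; exact hx.comm _ _
  · rintro rfl; exact hx.ne_one h1
  · apply f.injective; rw [h1]; exact hx.torsionFree k _ (by rw [← hp, h, h1])
  · obtain ⟨k, n, h⟩ := hx.rank (f a)
    refine ⟨k, n, h.imp (fun h => f.injective ?_) fun h => f.injective ?_⟩
    · simp only [hp, h]
    · simp only [hm, hp, h, h1]
  · rw [← hx.divides k, f.surjective.exists]
    simp only [← hp, f.injective.eq_iff]

theorem npowRec_eq_pow {M : Type} [Monoid M] (k : ℕ) (a : M) : npowRec k a = a ^ k := by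
  induction k with
  | zero => simp [npowRec]
  | succ k ih => simp [npowRec, ih, pow_succ]

/-- From `m * a + n * d = 1`, the element `m • y + n • x` is a quotient of `x` by `d`. That it is a
combination of `x` and `y` places it in every subgroup containing both. -/
theorem mem_smul_iff_of_coprime {A : Type} [AddCommGroup A] {a : ℤ} {d : ℕ} {x y : A}
    (hc : IsCoprime a (d : ℤ)) (h : d • y = a • x) : ∃ z : A, d • z = x ∧ ∃ m n : ℤ,
      z = m • y + n • x := by
  obtain ⟨m, n, hmn⟩ := hc
  refine ⟨m • y + n • x, ?_, m, n, rfl⟩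
  rw [← natCast_zsmul] at h
  rw [← natCast_zsmul, smul_add, smul_comm _ m, h, smul_smul, smul_smul, ← add_smul,
    mul_comm (d : ℤ) n, hmn, one_smul]

theorem nsmul_right_cancel {x y : ℚ} {k : ℕ} (hk : k ≠ 0) (h : k • x = k • y) : x = y := by
  simpa [hk] using h

/-- Write `x = (a/d)u` in lowest terms. By Bézout `u/d` lies in `A`, so `d` divides `u` in `A`,
hence in `G`, and `x = a • (u/d)`. -/
theorem le_of_dividesIn {A G : AddSubgroup ℚ} {u : ℚ} (hu : u ≠ 0) (huA : u ∈ A)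
    (h : ∀ k, DividesIn A k u → DividesIn G k u) : A ≤ G := by
  intro x hx
  set q := x / u with hq
  have e : q.den • x = q.num • u := by
    have : x = q * u := by rw [hq]; field_simp
    rw [this, nsmul_eq_mul, zsmul_eq_mul, ← mul_assoc, Rat.den_mul_eq_num]
  have hc : IsCoprime q.num (q.den : ℤ) := by
    rw [Int.isCoprime_iff_gcd_eq_one]; exact q.reduced
  obtain ⟨z, hz, m, n, rfl⟩ := mem_smul_iff_of_coprime hc e
  obtain ⟨g, hg, hgu⟩ := h q.den ⟨_, A.add_mem (A.zsmul_mem hx m) (A.zsmul_mem huA n), hz⟩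
  have : x = q.num • g := by
    apply nsmul_right_cancel q.den_nz
    rw [smul_comm, hgu, e]
  rw [this]
  exact G.zsmul_mem hg _

/-- If `d • y = a • x`, then `y` has to go to `(a/d)u`. Torsion-freeness makes this independent of
the chosen relation, and additive and injective. -/
theorem exists_embedding {A : Type} [AddCommGroup A] {x : A} (hx : x ≠ 0)
    (tf : ∀ (k : ℕ) (a : A), (k + 1) • a = 0 → a = 0)
    (rank : ∀ y : A, ∃ d : ℕ, ∃ a : ℤ, (d + 1) • y = a • x) {u : ℚ} (hu : u ≠ 0) :
    ∃ f : A →+ ℚ, Function.Injective f ∧ f x = u := by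
  have tfn : ∀ (k : ℕ) (a : A), k ≠ 0 → k • a = 0 → a = 0 := fun k a hk h => by
    obtain ⟨k, rfl⟩ := Nat.exists_eq_succ_of_ne_zero hk
    exact tf k a h
  have tfz : ∀ (k : ℤ), k • x = 0 → k = 0 := fun k h => by
    by_contra hk
    refine hx (tfn k.natAbs x (by simpa using hk) ?_)
    rcases Int.natAbs_eq k with e | e
    · rw [← natCast_zsmul, ← e, h]
    · rw [← natCast_zsmul, show (k.natAbs : ℤ) = -k by omega, neg_smul, h, neg_zero]
  choose d a h using rank
  have hd : ∀ y, ((d y + 1 : ℕ) : ℚ) ≠ 0 := fun y => by positivity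
  -- Any two relations between `y` and `x` have the same ratio: cross-multiply and use that only the
  -- zero multiple of `x` vanishes.
  have key : ∀ (y : A) (m : ℕ) (b : ℤ), m • y = b • x → (m : ℚ) * a y = (d y + 1 : ℕ) * b := by
    intro y m b hb
    have : ((m : ℤ) * a y - (d y + 1 : ℕ) * b) • x = 0 := by
      rw [sub_smul, mul_smul, mul_smul, ← h, ← hb, natCast_zsmul, natCast_zsmul,
        smul_comm, sub_self]
    have := tfz _ this
    exact_mod_cast sub_eq_zero.1 this
  let f : A → ℚ := fun y => a y / (d y + 1 : ℕ) * u
  have hf : ∀ y (m : ℕ) (b : ℤ), m • y = b • x → (m : ℚ) * f y = b * u := by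
    intro y m b hb
    have := key y m b hb
    have hd := hd y
    simp only [f]
    field_simp
    linear_combination this
  have hadd : ∀ y z, f (y + z) = f y + f z := by
    intro y z
    have hy := hf y _ _ (h y)
    have hz := hf z _ _ (h z)
    have hyz := hf (y + z) ((d y + 1) * (d z + 1)) (a y * (d z + 1 : ℕ) + a z * (d y + 1 : ℕ)) (by
      have e : ((d y + 1) * (d z + 1)) • (y + z)
          = (d z + 1) • ((d y + 1) • y) + (d y + 1) • ((d z + 1) • z) := by module
      rw [e, h, h]
      push_cast
      module)
    have h1 := hd y
    have h2 := hd z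
    push_cast at *
    have : ((d y : ℚ) + 1) * (d z + 1) ≠ 0 := mul_ne_zero h1 h2
    apply mul_left_cancel₀ this
    linear_combination hyz - (d z + 1) * hy - (d y + 1) * hz
  refine ⟨AddMonoidHom.mk' f hadd, ?_, ?_⟩
  · rw [injective_iff_map_eq_zero]
    intro y hy
    have hy' : f y = 0 := hy
    have := hf y _ _ (h y)
    rw [hy', mul_zero] at this
    have ha : a y = 0 := by
      have := (mul_eq_zero.1 this.symm).resolve_right hu
      exact_mod_cast this
    exact tf _ _ (by rw [h, ha, zero_smul])
  · have := hf x 1 1 (by simp)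
    simpa using this

theorem structIso_of_injective {A : Type} [AddCommGroup A] {f : A →+ ℚ}
    (hf : Function.Injective f) {G : AddSubgroup ℚ} (hG : f.range = G) :
    StructIso (Multiplicative A) (Multiplicative G) := by
  subst hG
  let e := AddMonoidHom.ofInjective hf
  exact ⟨(AddEquiv.toMultiplicative e).toEquiv, (AddEquiv.toMultiplicative e).map_mul,
    (AddEquiv.toMultiplicative e).map_inv, (AddEquiv.toMultiplicative e).map_one⟩

theorem isRankOne_subgroup {G : AddSubgroup ℚ} {u : ℚ} (huG : u ∈ G) (hu : u ≠ 0) :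
    IsRankOne (Multiplicative G) (Multiplicative.ofAdd ⟨u, huG⟩) {k | DividesIn G k u} := by
  have e : ∀ (a : G) (k : ℕ), ((Multiplicative.toAdd (Multiplicative.ofAdd a ^ k) : G) : ℚ)
      = k * (a : ℚ) := fun a k => by simp
  refine ⟨mul_assoc, one_mul, inv_mul_cancel, mul_comm, ?_, fun k a => ?_, fun a => ?_,
    fun k => ?_⟩
  · intro h
    exact hu (congrArg (fun z : Multiplicative G => ((Multiplicative.toAdd z : G) : ℚ)) h)
  · induction a with | ofAdd a =>
    rw [npowRec_eq_pow]
    intro h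
    have h' := congrArg (fun z : Multiplicative G => ((Multiplicative.toAdd z : G) : ℚ)) h
    simp only [e] at h'
    have ha : (a : ℚ) = 0 := by simpa [Nat.cast_add_one_ne_zero k] using h'
    have : a = 0 := Subtype.ext ha
    rw [this]; rfl
  · induction a with | ofAdd a =>
    simp only [npowRec_eq_pow]
    set q := (a : ℚ) / u with hq
    have hqd : (q.den : ℚ) * a = q.num * u := by
      have : (a : ℚ) = q * u := by rw [hq]; field_simp
      rw [this, ← mul_assoc, Rat.den_mul_eq_num]
    have hk : q.den - 1 + 1 = q.den := Nat.sub_add_cancel q.pos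
    refine ⟨q.den - 1, q.num.natAbs, ?_⟩
    -- The relation is `a / u` in lowest terms; the sign of its numerator decides between the two
    -- alternatives, which only involve natural exponents.
    rw [hk]
    rcases Int.natAbs_eq q.num with h | h
    · left
      apply Multiplicative.toAdd.injective
      apply Subtype.ext
      rw [e, e, hqd]
      congr 1
      rw [h]; simp
    · right
      apply Multiplicative.toAdd.injective
      apply Subtype.ext
      rw [toAdd_mul, AddSubgroup.coe_add, e, e, hqd, h]
      push_cast
      simp
  · simp only [npowRec_eq_pow]
    constructor
    · rintro ⟨a, h⟩
      refine ⟨((Multiplicative.toAdd a : G) : ℚ), SetLike.coe_mem _, ?_⟩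
      have := congrArg (fun z : Multiplicative G => ((Multiplicative.toAdd z : G) : ℚ)) h
      simpa using this
    · rintro ⟨y, hy, h⟩
      refine ⟨Multiplicative.ofAdd ⟨y, hy⟩, ?_⟩
      apply Multiplicative.toAdd.injective
      apply Subtype.ext
      rw [e]
      simpa using h

/-- Embed `M` into `ℚ` with `x` going to `u`. The image and `G` both contain `u` and have the same
divisors of `u`, so they coincide. -/
theorem IsRankOne.structIso {M : Type} [Mul M] [Inv M] [One M] {x : M} {G : AddSubgroup ℚ}
    {u : ℚ} (huG : u ∈ G) (hu : u ≠ 0) (h : IsRankOne M x {k | DividesIn G k u}) :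
    StructIso M (Multiplicative G) := by
  let _ : CommGroup M := { Group.ofLeftAxioms h.assoc h.one_mul h.inv_mul with mul_comm := h.comm }
  have hp : ∀ (k : ℕ) (a : M), npowRec k a = a ^ k := npowRec_eq_pow
  obtain ⟨f, hf, hfx⟩ := exists_embedding (A := Additive M) (x := Additive.ofMul x)
    (fun e => h.ne_one e) (fun k a e => h.torsionFree k a.toMul ((hp _ _).trans e))
    (fun y => by
      obtain ⟨k, n, e⟩ := h.rank y.toMul
      rw [hp, hp] at e
      rcases e with e | e
      · exact ⟨k, n, e.trans (zpow_natCast x n).symm⟩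
      · refine ⟨k, -n, ?_⟩
        have e' := eq_inv_of_mul_eq_one_left e
        rw [← zpow_natCast x n, ← zpow_neg] at e'
        exact e') hu
  have hx : u ∈ f.range := ⟨_, hfx⟩
  have hd : ∀ k, DividesIn f.range k u ↔ DividesIn G k u := by
    intro k
    refine Iff.trans ?_ (h.divides k)
    constructor
    · rintro ⟨_, ⟨y, rfl⟩, e⟩
      refine ⟨y.toMul, (hp _ _).trans ?_⟩
      have : k • y = Additive.ofMul x := hf (by rw [map_nsmul, e, hfx])
      exact this
    · rintro ⟨a, e⟩
      refine ⟨_, ⟨Additive.ofMul a, rfl⟩, ?_⟩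
      rw [← map_nsmul, ← hfx]
      exact congrArg f ((hp _ _).symm.trans e)
  exact structIso_of_injective hf (le_antisymm
    (le_of_dividesIn hu hx fun k => (hd k).1) (le_of_dividesIn hu huG fun k => (hd k).2))

theorem structIso_iff_isRankOne {M : Type} [Mul M] [Inv M] [One M] {G : AddSubgroup ℚ}
    {u : ℚ} (huG : u ∈ G) (hu : u ≠ 0) :
    StructIso M (Multiplicative G) ↔ ∃ x, IsRankOne M x {k | DividesIn G k u} :=
  ⟨fun h => IsRankOne.of_structIso h (isRankOne_subgroup huG hu),
    fun ⟨_, h⟩ => h.structIso huG hu⟩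

/-! ## Intersections of the subgroups `p • G` -/

/-- The intersection of `G` and all `p • G` for `p ∈ Q`. -/
def divisibleBy (G : AddSubgroup ℚ) (Q : Set ℕ) : AddSubgroup ℚ where
  carrier := {x | x ∈ G ∧ ∀ p ∈ Q, DividesIn G p x}
  add_mem' := by
    rintro x y ⟨hx, hx'⟩ ⟨hy, hy'⟩
    refine ⟨G.add_mem hx hy, fun p hp => ?_⟩
    obtain ⟨z, hz, rfl⟩ := hx' p hp
    obtain ⟨w, hw, rfl⟩ := hy' p hp
    exact ⟨z + w, G.add_mem hz hw, smul_add _ _ _⟩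
  zero_mem' := ⟨G.zero_mem, fun _ _ => ⟨0, G.zero_mem, smul_zero _⟩⟩
  neg_mem' := by
    rintro x ⟨hx, hx'⟩
    refine ⟨G.neg_mem hx, fun p hp => ?_⟩
    obtain ⟨z, hz, rfl⟩ := hx' p hp
    exact ⟨-z, G.neg_mem hz, smul_neg _ _⟩

/-- If `a * m + b * n = 1`, then `x/(mn) = a(x/n) + b(x/m)`. -/
theorem dividesIn_mul {G : AddSubgroup ℚ} {m n : ℕ} (h : m.Coprime n) {x : ℚ} :
    DividesIn G (m * n) x ↔ DividesIn G m x ∧ DividesIn G n x := by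
  constructor
  · rintro ⟨y, hy, rfl⟩
    exact ⟨⟨n • y, G.nsmul_mem hy _, smul_smul _ _ _⟩, ⟨m • y, G.nsmul_mem hy _, by
      rw [smul_smul, mul_comm]⟩⟩
  · rintro ⟨⟨y, hy, hyx⟩, z, hz, hzx⟩
    obtain ⟨a, b, hab⟩ := Nat.isCoprime_iff_coprime.2 h
    refine ⟨a • z + b • y, G.add_mem (G.zsmul_mem hz _) (G.zsmul_mem hy _), ?_⟩
    have hab' : (a : ℚ) * m + b * n = 1 := by exact_mod_cast hab
    rw [nsmul_eq_mul] at hyx hzx ⊢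
    rw [zsmul_eq_mul, zsmul_eq_mul]
    push_cast
    linear_combination a * m * hzx + b * n * hyx + x * hab'

theorem dividesIn_prod {G : AddSubgroup ℚ} {Q : Finset ℕ} (hQ : ∀ p ∈ Q, p.Prime) {x : ℚ}
    (hx : x ∈ G) : DividesIn G (∏ p ∈ Q, p) x ↔ ∀ p ∈ Q, DividesIn G p x := by
  induction Q using Finset.induction_on with
  | empty => simpa using ⟨x, hx, by simp⟩
  | insert q Q hq ih =>
    rw [Finset.prod_insert hq, dividesIn_mul, ih fun p hp => hQ p (Finset.mem_insert_of_mem hp),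
      Finset.forall_mem_insert]
    refine Nat.Coprime.prod_right fun p hp => ?_
    rw [Nat.coprime_primes (hQ q (Finset.mem_insert_self _ _))
      (hQ p (Finset.mem_insert_of_mem hp))]
    rintro rfl
    exact hq hp

/-- With `N` the product of `Q`, the intersection is `N • G`, and multiplication by `N` is
injective. -/
theorem structIso_divisibleBy {G : AddSubgroup ℚ} {Q : Set ℕ} (hQ : ∀ p ∈ Q, p.Prime)
    (hfin : Q.Finite) :
    StructIso (Multiplicative G) (Multiplicative (divisibleBy G Q)) := by
  have hN : ((∏ p ∈ hfin.toFinset, p : ℕ) : ℚ) ≠ 0 := by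
    rw [Nat.cast_ne_zero, Finset.prod_ne_zero_iff]
    intro p hp
    exact (hQ p (by simpa using hp)).ne_zero
  have hQ' : ∀ p ∈ hfin.toFinset, p.Prime := fun p hp => hQ p (by simpa using hp)
  refine structIso_of_injective
    (f := (nsmulAddMonoidHom (∏ p ∈ hfin.toFinset, p)).comp G.subtype) ?_ ?_
  · intro x y h
    apply Subtype.ext
    exact nsmul_right_cancel (by exact_mod_cast hN) h
  · ext x
    constructor
    · rintro ⟨y, rfl⟩
      have hx : (∏ p ∈ hfin.toFinset, p) • (y : ℚ) ∈ G := G.nsmul_mem y.2 _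
      refine ⟨hx, fun p hp => ?_⟩
      exact (dividesIn_prod hQ' hx).1 ⟨y, y.2, rfl⟩ p (by simpa using hp)
    · rintro ⟨hx, hxQ⟩
      obtain ⟨y, hy, h⟩ := (dividesIn_prod hQ' hx).2 fun p hp => hxQ p (by simpa using hp)
      exact ⟨⟨y, hy⟩, h⟩

/-- Let `v` be the image of `u` and `v/u = a/b` in lowest terms. Choose `p ∈ Q` not dividing `a`,
with `p ^ k` the exact power of `p` dividing `u`. The image of `u/p^k` is divisible by `p` in `G`,
so `p ^ (k + 1)` divides `v` and hence `bv = au`; as `p` does not divide `a`, it divides `u`, a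
contradiction. Surjectivity of the isomorphism plays no role. -/
theorem not_structIso_divisibleBy {G : AddSubgroup ℚ} {u : ℚ} (huG : u ∈ G) (hu : u ≠ 0)
    {Q : Set ℕ} (hinf : (Q ∩ primesFin G u).Infinite) :
    ¬ StructIso (Multiplicative G) (Multiplicative (divisibleBy G Q)) := by
  rintro ⟨f, hm, -, h1⟩
  let g : G →+ ℚ := AddMonoidHom.mk'
    (fun x => ((Multiplicative.toAdd (f (Multiplicative.ofAdd x)) : divisibleBy G Q) : ℚ))
    (fun x y => by rw [ofAdd_add, hm, toAdd_mul, AddSubgroup.coe_add])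
  have hg : ∀ x, g x ∈ divisibleBy G Q := fun x => SetLike.coe_mem _
  have hginj : Function.Injective g := fun x y h =>
    Multiplicative.ofAdd.injective (f.injective (Multiplicative.toAdd.injective (Subtype.ext h)))
  set v := g ⟨u, huG⟩ with hv
  have hv0 : v ≠ 0 := by
    intro h
    have := hginj ((hv.symm.trans h).trans (map_zero g).symm)
    exact hu (congrArg Subtype.val this)
  set q := v / u with hq
  have hq0 : q ≠ 0 := div_ne_zero hv0 hu
  have hqv : (q.den : ℚ) * v = q.num * u := by
    have : v = q * u := by rw [hq]; field_simp
    rw [this, ← mul_assoc, Rat.den_mul_eq_num]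
  obtain ⟨p, ⟨hpQ, hp, k, hk, ⟨y, hy, hyu⟩, hnd⟩, hpn⟩ :=
    hinf.exists_notMem_finset q.num.natAbs.primeFactors
  apply hnd
  have hpk : ((p : ℚ) ^ k) ≠ 0 := pow_ne_zero _ (by exact_mod_cast hp.ne_zero)
  obtain ⟨-, hdiv⟩ := hg ⟨y, hy⟩
  obtain ⟨z, hz, hzy⟩ := hdiv p hpQ
  have e1 : (p : ℚ) ^ k * g ⟨y, hy⟩ = v := by
    have : p ^ k • (⟨y, hy⟩ : G) = ⟨u, huG⟩ := Subtype.ext hyu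
    rw [hv, ← this, map_nsmul, nsmul_eq_mul]
    push_cast; rfl
  have hcop : IsCoprime q.num (p : ℤ) := by
    rw [isCoprime_comm, (Nat.prime_iff_prime_int.1 hp).irreducible.coprime_iff_not_dvd]
    intro h
    apply hpn
    rw [Nat.mem_primeFactors]
    exact ⟨hp, Int.natCast_dvd.1 h, by simpa using hq0⟩
  obtain ⟨s, t, hst⟩ := hcop
  have hst' : (s : ℚ) * q.num + t * p = 1 := by exact_mod_cast hst
  rw [nsmul_eq_mul] at hzy hyu
  push_cast at hyu
  have e2 : (q.num : ℚ) * y = q.den * (p * z) := by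
    apply mul_left_cancel₀ hpk
    rw [hzy]
    linear_combination q.num * hyu - hqv + q.den * e1.symm
  -- This is `y/p`: multiply `s * q.num + t * p = 1` by `y` and replace `q.num * y` by `q.den * p *
  -- z`.
  refine ⟨(s * q.den) • z + t • y, G.add_mem (G.zsmul_mem hz _) (G.zsmul_mem hy _), ?_⟩
  rw [nsmul_eq_mul, zsmul_eq_mul, zsmul_eq_mul]
  push_cast
  linear_combination hyu + p ^ k * (- s * e2 + y * hst')

/-- If `p` divides `u` but not `d + 1`, then `p` divides `(d + 1) • x = ± n • u`, and Bézout makes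
it divide `x`. Only the prime factors of `d + 1` remain to be tested; the bound `p < d + 2`, implied
by `p ∣ d + 1`, makes that a bounded quantifier. -/
theorem mem_divisibleBy_iff {G : AddSubgroup ℚ} {u : ℚ} (hu : u ≠ 0) {Q : Set ℕ}
    (hQ : ∀ p ∈ Q, p.Prime ∧ DividesIn G p u) {x : ℚ} (hx : x ∈ G) :
    x ∈ divisibleBy G Q ↔ ∃ d n : ℕ, ((d + 1) • x = n • u ∨ (d + 1) • x + n • u = 0) ∧
      ∀ p < d + 2, p ∣ d + 1 → p ∈ Q → DividesIn G p x := by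
  constructor
  · rintro ⟨-, h⟩
    set q := x / u with hq
    have hqd : (q.den : ℚ) * x = q.num * u := by
      have : x = q * u := by rw [hq]; field_simp
      rw [this, ← mul_assoc, Rat.den_mul_eq_num]
    have hk : q.den - 1 + 1 = q.den := Nat.sub_add_cancel q.pos
    refine ⟨q.den - 1, q.num.natAbs, ?_, fun p _ _ hp => h p hp⟩
    rw [hk, nsmul_eq_mul, nsmul_eq_mul, hqd]
    rcases Int.natAbs_eq q.num with h | h
    · left; congr 1; rw [h]; simp
    · right; rw [h]; push_cast; simp
  · rintro ⟨d, n, h, hdiv⟩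
    refine ⟨hx, fun p hp => ?_⟩
    obtain ⟨hpp, y, hy, hyu⟩ := hQ p hp
    by_cases hpd : p ∣ d + 1
    · exact hdiv p (Nat.lt_succ_of_le (Nat.le_of_dvd d.succ_pos hpd)) hpd hp
    · have hcop : IsCoprime ((d + 1 : ℕ) : ℤ) (p : ℤ) :=
        Nat.isCoprime_iff_coprime.2 ((Nat.Prime.coprime_iff_not_dvd hpp).2 hpd).symm
      have hw : ∃ w ∈ G, (d + 1) • x = p • w := by
        rcases h with h | h
        · exact ⟨n • y, G.nsmul_mem hy _, by rw [smul_comm, hyu, h]⟩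
        · refine ⟨-(n • y), G.neg_mem (G.nsmul_mem hy _), ?_⟩
          rw [smul_neg, smul_comm, hyu]
          exact eq_neg_of_add_eq_zero_left h
      obtain ⟨w, hwG, hw⟩ := hw
      have hw' : p • w = ((d + 1 : ℕ) : ℤ) • x := by rw [← hw, natCast_zsmul]
      obtain ⟨z, hz, a, b, rfl⟩ := mem_smul_iff_of_coprime hcop hw'
      exact ⟨_, G.add_mem (G.zsmul_mem hwG _) (G.zsmul_mem hx _), hz⟩

end InfGroup

namespace InfGroup

/-! ## Atomic diagrams -/

section Diagram

variable {M : Type} [Mul M] [Inv M] [One M]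

theorem GTerm.value_pow (v : ℕ → M) (t : GTerm) (k : ℕ) :
    (t.pow k).value v = npowRec k (t.value v) := by
  induction k with
  | zero => rfl
  | succ k ih => simp only [pow, value, npowRec, ih]

theorem QFFormula.holds_congr {v w : ℕ → M} (φ : QFFormula) (h : ∀ x ∈ φ.vars, v x = w x) :
    φ.Holds v ↔ φ.Holds w := by
  induction φ with
  | eq s t =>
    simp only [Holds, s.value_congr fun x hx => h x (Or.inl hx),
      t.value_congr fun x hx => h x (Or.inr hx)]
  | ne s t =>
    simp only [Holds, s.value_congr fun x hx => h x (Or.inl hx),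
      t.value_congr fun x hx => h x (Or.inr hx)]
  | conj φ ψ ihφ ihψ =>
    simp only [Holds, ihφ fun x hx => h x (Or.inl hx), ihψ fun x hx => h x (Or.inr hx)]
  | disj φ ψ ihφ ihψ =>
    simp only [Holds, ihφ fun x hx => h x (Or.inl hx), ihψ fun x hx => h x (Or.inr hx)]

namespace NatStructure

variable (B : NatStructure)

open Classical in
/-- The assignment under which every element of `B` names itself. -/
noncomputable def assign (n : ℕ) : B.carrier := if h : n ∈ B.carrier then ⟨n, h⟩ else 1

theorem assign_coe (b : B.carrier) : B.assign b = b := by simp [assign]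

theorem assign_of_mem {n : ℕ} (h : n ∈ B.carrier) : B.assign n = ⟨n, h⟩ := by simp [assign, h]

/-- The literal `φ` belongs to the atomic diagram of `B`. -/
def Sat (φ : QFFormula) : Prop := φ.toNat ∈ B.atomicDiagram

/-- All assignments naming the elements correctly agree on the symbols of `φ`, since these lie in
the carrier; testing `assign` alone is enough. -/
theorem sat_iff (φ : QFFormula) :
    B.Sat φ ↔ φ.IsLiteral ∧ φ.vars ⊆ B.carrier ∧ φ.Holds B.assign := by
  rw [Sat, atomicDiagram, Set.mem_ofPred_eq, QFFormula.ofNat_toNat]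
  refine and_congr_right fun _ => and_congr_right fun h => ⟨fun H => H _ B.assign_coe,
    fun H v hv => (φ.holds_congr fun x hx => ?_).1 H⟩
  exact (B.assign_of_mem (h hx)).trans (hv ⟨x, h hx⟩).symm

theorem mem_atomicDiagram (n : ℕ) : n ∈ B.atomicDiagram ↔ B.Sat (QFFormula.ofNat n) := by
  rw [Sat, QFFormula.toNat_ofNat]

theorem sat_eq_iff (s t : GTerm) : B.Sat (.eq s t) ↔
    (s.vars ⊆ B.carrier ∧ t.vars ⊆ B.carrier) ∧ s.value B.assign = t.value B.assign := by
  simp [sat_iff, QFFormula.IsLiteral, QFFormula.vars, QFFormula.Holds]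

theorem sat_ne_iff (s t : GTerm) : B.Sat (.ne s t) ↔
    (s.vars ⊆ B.carrier ∧ t.vars ⊆ B.carrier) ∧ s.value B.assign ≠ t.value B.assign := by
  simp [sat_iff, QFFormula.IsLiteral, QFFormula.vars, QFFormula.Holds]

theorem sat_self_iff (t : GTerm) : B.Sat (.eq t t) ↔ t.vars ⊆ B.carrier := by
  simp [sat_eq_iff]

theorem value_pow_var (k : ℕ) (b : B.carrier) :
    ((GTerm.var b).pow k).value B.assign = npowRec k b := by
  rw [GTerm.value_pow, GTerm.value, assign_coe]

theorem vars_pow_var (k : ℕ) (b : B.carrier) : ((GTerm.var b).pow k).vars ⊆ B.carrier :=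
  (GTerm.vars_pow_subset _ _).trans (by simp [GTerm.vars])

variable {B}

theorem IsComputable.sat (hB : B.IsComputable) : ComputablePred B.Sat :=
  hB.comp (p := fun n => n ∈ B.atomicDiagram) Computable.encode

theorem IsComputable.mem_carrier (hB : B.IsComputable) :
    ComputablePred fun n => n ∈ B.carrier :=
  (hB.sat.comp (f := fun n : ℕ => QFFormula.eq (.var n) (.var n)) (by fun_prop)).of_eq
    fun n => by rw [sat_self_iff]; simp [GTerm.vars]

end NatStructure

end Diagram

theorem sig1_exists_npowRec {B : NatStructure} (hB : B.IsComputable) :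
    Sig1 fun x : ℕ × ℕ => ∃ a : B.carrier, npowRec x.1 a = B.assign x.2 := by
  -- The second disjunct covers numbers outside the carrier, where `assign` takes its default value
  -- `1`.
  have h : Sig1 fun x : ℕ × ℕ => (∃ n : ℕ, B.Sat (.eq ((GTerm.var n).pow x.1)
      (.var x.2))) ∨ (∃ n : ℕ, B.Sat (.eq ((GTerm.var n).pow x.1) .one) ∧ x.2 ∉ B.carrier) := by
    refine Sig1.or (Sig1.ex (P := fun (x : ℕ × ℕ) n => B.Sat (.eq ((GTerm.var n).pow x.1) (.var x.2)))
      (hB.sat.comp ?_).sig1) (Sig1.ex (P := fun (x : ℕ × ℕ) n => B.Sat (.eq ((GTerm.var n).pow x.1) .one)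
        ∧ x.2 ∉ B.carrier) (ComputablePred.and (hB.sat.comp ?_)
          (hB.mem_carrier.not.comp ?_)).sig1) <;> fun_prop
  refine h.of_eq fun x => ?_
  simp only [B.sat_eq_iff, GTerm.value, GTerm.vars, GTerm.value_pow, Set.singleton_subset_iff]
  constructor
  · rintro (⟨n, -, h⟩ | ⟨n, ⟨-, h⟩, hx⟩)
    · exact ⟨_, h⟩
    · exact ⟨_, by rw [h]; simp [NatStructure.assign, hx]⟩
  · rintro ⟨a, h⟩
    by_cases hx : x.2 ∈ B.carrier
    · exact Or.inl ⟨a, ⟨B.vars_pow_var _ _, hx⟩, by rw [B.assign_coe]; exact h⟩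
    · refine Or.inr ⟨a, ⟨⟨B.vars_pow_var _ _, by simp⟩, ?_⟩, hx⟩
      rw [B.assign_coe, h]; simp [NatStructure.assign, hx]

/-- A computable copy of `G` has an element with the same divisors as `u`, and there a quotient can
be searched for. -/
theorem sig1_dividesIn {G : AddSubgroup ℚ} (hG : IsComputablyPresented (Multiplicative G))
    {u : ℚ} (huG : u ∈ G) (hu : u ≠ 0) : Sig1 fun k => DividesIn G k u := by
  obtain ⟨B, hB, hBG⟩ := hG
  obtain ⟨y, hy⟩ := (structIso_iff_isRankOne huG hu).1 hBG
  refine ((sig1_exists_npowRec hB).comp (f := fun k : ℕ => (k, (y : ℕ)))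
    (by fun_prop)).of_eq fun k => ?_
  rw [B.assign_coe]
  exact hy.divides k

/-! ## Computable formulas -/

section Formulas

variable {M : Type} [Mul M] [Inv M] [One M]

/-- The code of a disjunct or conjunct with the given components. -/
def memberCode (m : ℕ) (xs : List ℕ) (i : ℕ) : ℕ := Encodable.encode (m, xs, i)

theorem member_memberCode (m : ℕ) (xs : List ℕ) (i : ℕ) :
    member (memberCode m xs i) = (m, xs, i) := Denumerable.ofNat_encode _

theorem memberCode_member (c : ℕ) :
    memberCode (member c).1 (member c).2.1 (member c).2.2 = c := Denumerable.encode_ofNat _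

@[simp]
theorem memberCode_inj {m m' i i' : ℕ} {xs xs' : List ℕ} :
    memberCode m xs i = memberCode m' xs' i' ↔ m = m' ∧ xs = xs' ∧ i = i' := by
  simp [memberCode]

@[fun_prop]
theorem computable_memberCode {α : Type} [Primcodable α] {m i : α → ℕ} {xs : α → List ℕ}
    (hm : Computable m) (hxs : Computable xs) (hi : Computable i) :
    Computable fun a => memberCode (m a) (xs a) (i a) := by
  unfold memberCode; fun_prop

theorem holds_sigmaFormula_zero (φ : QFFormula) (v : ℕ → M) :
    (sigmaFormula 0 φ.toNat).Holds v ↔ φ.Holds v := by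
  rw [sigmaFormula, InfFormula.Holds, ofNat_formula, QFFormula.ofNat_toNat]

theorem holds_piFormula_zero (φ : QFFormula) (v : ℕ → M) :
    (piFormula 0 φ.toNat).Holds v ↔ φ.Holds v := by
  rw [piFormula, InfFormula.Holds, ofNat_formula, QFFormula.ofNat_toNat]

theorem freeVars_sigmaFormula_zero (φ : QFFormula) :
    (sigmaFormula 0 φ.toNat).freeVars = φ.vars := by
  rw [sigmaFormula, InfFormula.freeVars, ofNat_formula, QFFormula.ofNat_toNat]

theorem freeVars_piFormula_zero (φ : QFFormula) :
    (piFormula 0 φ.toNat).freeVars = φ.vars := by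
  rw [piFormula, InfFormula.freeVars, ofNat_formula, QFFormula.ofNat_toNat]

theorem holds_sigmaFormula_succ (n e : ℕ) (v : ℕ → M) :
    (sigmaFormula (n + 1) e).Holds v ↔ ∃ m xs i, memberCode m xs i ∈ W e ∧ m ≤ n ∧
      ∃ w : ℕ → M, (∀ x, x ∉ xs → w x = v x) ∧ (piFormula m i).Holds w := by
  rw [sigmaFormula, InfFormula.Holds]
  constructor
  · rintro ⟨⟨c, hc, hn⟩, h⟩
    exact ⟨_, _, _, by rwa [memberCode_member], hn, h⟩
  · rintro ⟨m, xs, i, hc, hn, h⟩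
    refine ⟨⟨memberCode m xs i, hc, by rwa [member_memberCode]⟩, ?_⟩
    rw [InfFormula.Holds]
    simpa only [member_memberCode] using h

theorem holds_piFormula_succ (n e : ℕ) (v : ℕ → M) :
    (piFormula (n + 1) e).Holds v ↔ ∀ m xs i, memberCode m xs i ∈ W e → m ≤ n →
      ∀ w : ℕ → M, (∀ x, x ∉ xs → w x = v x) → (sigmaFormula m i).Holds w := by
  rw [piFormula, InfFormula.Holds]
  constructor
  · intro H m xs i hc hn
    have h := H ⟨memberCode m xs i, hc, by rwa [member_memberCode]⟩
    rw [InfFormula.Holds] at h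
    simpa only [member_memberCode] using h
  · rintro H ⟨c, hc, hn⟩
    exact H _ _ _ (by rwa [memberCode_member]) hn

theorem mem_freeVars_sigmaFormula_succ (n e x : ℕ) :
    x ∈ (sigmaFormula (n + 1) e).freeVars ↔ ∃ m xs i, memberCode m xs i ∈ W e ∧ m ≤ n ∧
      x ∈ (piFormula m i).freeVars ∧ x ∉ xs := by
  rw [sigmaFormula, InfFormula.freeVars, Set.mem_iUnion]
  constructor
  · rintro ⟨⟨c, hc, hn⟩, h⟩
    exact ⟨_, _, _, by rwa [memberCode_member], hn, h⟩
  · rintro ⟨m, xs, i, hc, hn, h⟩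
    refine ⟨⟨memberCode m xs i, hc, by rwa [member_memberCode]⟩, ?_⟩
    rw [InfFormula.freeVars]
    simp only [member_memberCode]
    exact h

theorem mem_freeVars_piFormula_succ (n e x : ℕ) :
    x ∈ (piFormula (n + 1) e).freeVars ↔ ∃ m xs i, memberCode m xs i ∈ W e ∧ m ≤ n ∧
      x ∈ (sigmaFormula m i).freeVars ∧ x ∉ xs := by
  rw [piFormula, InfFormula.freeVars, Set.mem_iUnion]
  constructor
  · rintro ⟨⟨c, hc, hn⟩, h⟩
    exact ⟨_, _, _, by rwa [memberCode_member], hn, h⟩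
  · rintro ⟨m, xs, i, hc, hn, h⟩
    refine ⟨⟨memberCode m xs i, hc, by rwa [member_memberCode]⟩, ?_⟩
    rw [InfFormula.freeVars]
    simp only [member_memberCode]
    exact h

end Formulas

/-! ## The Scott sentence -/

section ScottSentence

open QFFormula

/-- The laws of abelian groups for the variables `1`, `2`, `3`. -/
def abelianGroupLaws : QFFormula :=
  conj (conj (eq (.mul (.mul (.var 1) (.var 2)) (.var 3)) (.mul (.var 1) (.mul (.var 2) (.var 3))))
      (eq (.mul .one (.var 1)) (.var 1)))
    (conj (eq (.mul (.inv (.var 1)) (.var 1)) .one)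
      (eq (.mul (.var 1) (.var 2)) (.mul (.var 2) (.var 1))))

/-- If the `k`-th power of `1` is trivial, so is `1`. -/
def torsionFreeLaw (k : ℕ) : QFFormula :=
  disj (ne ((GTerm.var 1).pow (k + 1)) .one) (eq (.var 1) .one)

/-- The variable `1` depends on the variable `0`. -/
def dependence (k n : ℕ) : QFFormula :=
  disj (eq ((GTerm.var 1).pow (k + 1)) ((GTerm.var 0).pow n))
    (eq (.mul ((GTerm.var 1).pow (k + 1)) ((GTerm.var 0).pow n)) .one)

theorem exists_index_dependence : ∃ j, ∀ c, c ∈ W j ↔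
    ∃ k n, c = memberCode 0 [] (dependence k n).toNat := by
  have h : Sig1 fun x : ℕ × ℕ => ∃ y : ℕ × ℕ, x.2 = memberCode 0 []
      (Encodable.encode (dependence y.1 y.2)) := by
    refine Sig1.ex (P := fun (x : ℕ × ℕ) (y : ℕ × ℕ) => x.2 = memberCode 0 []
      (Encodable.encode (dependence y.1 y.2))) (ComputablePred.sig1 ?_)
    unfold dependence
    fun_prop
  obtain ⟨f, -, hf⟩ := Sig1.exists_index (P := fun _ c => ∃ y : ℕ × ℕ, c = memberCode 0 []
      (Encodable.encode (dependence y.1 y.2))) h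
  exact ⟨f 0, fun c => by rw [hf, Prod.exists]; rfl⟩

/-- Since `S` is only c.e., the non-divisors cannot be listed. Instead each `k` gets a disjunction
which acquires a trivially true disjunct as soon as `k` is enumerated into `S`. -/
theorem exists_index_nonDivisibility {S : Set ℕ} (hS : Sig1 fun k => k ∈ S) :
    ∃ f : ℕ → ℕ, Computable f ∧ ∀ k c, c ∈ W (f k) ↔
      c = memberCode 0 [] (ne ((GTerm.var 1).pow k) (.var 0)).toNat ∨
      k ∈ S ∧ c = memberCode 0 [] (eq .one .one).toNat := by
  refine Sig1.exists_index (P := fun k c =>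
    c = memberCode 0 [] (Encodable.encode (ne ((GTerm.var 1).pow k) (.var 0))) ∨
      k ∈ S ∧ c = memberCode 0 [] (eq .one .one).toNat) ?_
  exact (ComputablePred.sig1 (by fun_prop)).or
    ((hS.comp (by fun_prop)).and (ComputablePred.sig1 (by fun_prop)))

theorem exists_index_divisibility :
    ∃ f : ℕ → ℕ, Computable f ∧ ∀ k c, c ∈ W (f k) ↔
      c = memberCode 0 [1] (eq ((GTerm.var 1).pow k) (.var 0)).toNat := by
  refine Sig1.exists_index (P := fun k c =>
    c = memberCode 0 [1] (Encodable.encode (eq ((GTerm.var 1).pow k) (.var 0)))) ?_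
  exact ComputablePred.sig1 (by fun_prop)

/-- These are the conjuncts of the `Π₂` part. Variable `0` stays free for the distinguished element,
and positive divisibility is required only for the `k` enumerated into `S`. -/
theorem exists_index_laws {S : Set ℕ} (hS : Sig1 fun k => k ∈ S) (j : ℕ) {f g : ℕ → ℕ}
    (hf : Computable f) (hg : Computable g) :
    ∃ i, ∀ c, c ∈ W i ↔ c = memberCode 0 [1, 2, 3] abelianGroupLaws.toNat ∨
      c = memberCode 0 [] (ne (.var 0) .one).toNat ∨
      (∃ k, c = memberCode 0 [1] (torsionFreeLaw k).toNat) ∨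
      c = memberCode 1 [1] j ∨ (∃ k, c = memberCode 1 [1] (f k)) ∨
      ∃ k, k ∈ S ∧ c = memberCode 1 [] (g k) := by
  have h : Sig1 fun x : ℕ × ℕ => x.2 = memberCode 0 [1, 2, 3] abelianGroupLaws.toNat ∨
      x.2 = memberCode 0 [] (ne (.var 0) .one).toNat ∨
      (∃ k, x.2 = memberCode 0 [1] (Encodable.encode (torsionFreeLaw k))) ∨
      x.2 = memberCode 1 [1] j ∨ (∃ k, x.2 = memberCode 1 [1] (f k)) ∨
      ∃ k, k ∈ S ∧ x.2 = memberCode 1 [] (g k) := by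
    refine .or (ComputablePred.sig1 (by fun_prop)) (.or (ComputablePred.sig1 (by fun_prop))
      (.or (Sig1.ex (P := fun (x : ℕ × ℕ) k => x.2 = memberCode 0 [1]
        (Encodable.encode (torsionFreeLaw k))) (ComputablePred.sig1 ?_))
      (.or (ComputablePred.sig1 (by fun_prop))
      (.or (Sig1.ex (P := fun (x : ℕ × ℕ) k => x.2 = memberCode 1 [1] (f k))
        (ComputablePred.sig1 (by fun_prop)))
      (Sig1.ex (P := fun (x : ℕ × ℕ) k => k ∈ S ∧ x.2 = memberCode 1 [] (g k))
        ((hS.comp (by fun_prop)).and (ComputablePred.sig1 (by fun_prop))))))))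
    unfold torsionFreeLaw
    fun_prop
  obtain ⟨f', -, hf'⟩ := Sig1.exists_index (γ := ℕ) (P := fun _ c =>
      c = memberCode 0 [1, 2, 3] abelianGroupLaws.toNat ∨
      c = memberCode 0 [] (ne (.var 0) .one).toNat ∨
      (∃ k, c = memberCode 0 [1] (Encodable.encode (torsionFreeLaw k))) ∨
      c = memberCode 1 [1] j ∨ (∃ k, c = memberCode 1 [1] (f k)) ∨
      ∃ k, k ∈ S ∧ c = memberCode 1 [] (g k)) h
  exact ⟨f' 0, hf' 0⟩

theorem exists_index_singleton (c : ℕ) : ∃ e, ∀ n, n ∈ W e ↔ n = c := by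
  obtain ⟨f, -, hf⟩ := Sig1.exists_index (γ := ℕ) (P := fun _ n => n = c)
    (ComputablePred.sig1 (by fun_prop))
  exact ⟨f 0, hf 0⟩

theorem exists_sigma3_isRankOne {S : Set ℕ} (hS : Sig1 fun k => k ∈ S) :
    ∃ φ, IsComputableSigma 3 φ ∧ φ.IsSentence ∧ ∀ (M : Type) [Mul M] [Inv M] [One M] (v : ℕ → M),
      φ.Holds v ↔ ∃ x : M, IsRankOne M x S := by
  obtain ⟨j, hj⟩ := exists_index_dependence
  obtain ⟨f, hfc, hf⟩ := exists_index_nonDivisibility hS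
  obtain ⟨g, hgc, hg⟩ := exists_index_divisibility
  obtain ⟨i, hi⟩ := exists_index_laws hS j hfc hgc
  -- One disjunct: `∃` over variable `0` in front of the `Π₂` formula with index `i`.
  obtain ⟨e, he⟩ := exists_index_singleton (memberCode 2 [0] i)
  have hpow : ∀ {x y k}, x ∈ ((GTerm.var y).pow k).vars → x = y := fun h =>
    GTerm.vars_pow_subset _ _ h
  refine ⟨_, ⟨e, rfl⟩, ?_, fun M _ _ _ v => ?_⟩
  · rw [InfFormula.IsSentence, Set.eq_empty_iff_forall_notMem]
    intro x hx
    simp only [mem_freeVars_sigmaFormula_succ, he, memberCode_inj] at hx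
    obtain ⟨_, _, _, ⟨rfl, rfl, rfl⟩, -, hx, hx0⟩ := hx
    simp only [mem_freeVars_piFormula_succ, hi, memberCode_inj] at hx
    obtain ⟨_, _, _, ⟨rfl, rfl, rfl⟩ | ⟨rfl, rfl, rfl⟩ | ⟨k, rfl, rfl, rfl⟩ | ⟨rfl, rfl, rfl⟩ |
      ⟨k, rfl, rfl, rfl⟩ | ⟨k, hk, rfl, rfl, rfl⟩, -, hx, hx1⟩ := hx
    · rw [freeVars_sigmaFormula_zero] at hx
      simp [abelianGroupLaws, QFFormula.vars, GTerm.vars] at hx hx1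
      tauto
    · rw [freeVars_sigmaFormula_zero] at hx
      simp [QFFormula.vars, GTerm.vars] at hx hx0
      exact hx0 hx
    · rw [freeVars_sigmaFormula_zero] at hx
      simp only [torsionFreeLaw, QFFormula.vars, GTerm.vars, Set.mem_union, Set.mem_singleton_iff,
        Set.mem_empty_iff_false, or_false, List.mem_singleton] at hx hx1
      rcases hx with hx | hx
      exacts [hx1 (hpow hx), hx1 hx]
    · simp only [mem_freeVars_sigmaFormula_succ, hj] at hx
      obtain ⟨_, _, _, ⟨k, n, hx⟩, -, hx', -⟩ := hx
      obtain ⟨rfl, rfl, rfl⟩ := memberCode_inj.1 hx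
      rw [freeVars_piFormula_zero] at hx'
      simp only [dependence, QFFormula.vars, GTerm.vars, Set.mem_union,
        Set.mem_empty_iff_false, or_false, List.mem_singleton] at hx' hx1 hx0
      rcases hx' with (h | h) | h | h <;> first | exact hx1 (hpow h) | exact hx0 (hpow h)
    · simp only [mem_freeVars_sigmaFormula_succ, hf] at hx
      obtain ⟨_, _, _, hx | ⟨-, hx⟩, -, hx', -⟩ := hx
      all_goals
        obtain ⟨rfl, rfl, rfl⟩ := memberCode_inj.1 hx
        rw [freeVars_piFormula_zero] at hx'
        simp only [QFFormula.vars, GTerm.vars, Set.mem_union, Set.mem_singleton_iff,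
        Set.mem_empty_iff_false, or_false, List.mem_singleton] at hx' hx1 hx0
      rcases hx' with h | h
      exacts [hx1 (hpow h), hx0 h]
    · simp only [mem_freeVars_sigmaFormula_succ, hg] at hx
      obtain ⟨_, _, _, hx, -, hx', hx2⟩ := hx
      obtain ⟨rfl, rfl, rfl⟩ := memberCode_inj.1 hx
      rw [freeVars_piFormula_zero] at hx'
      simp only [QFFormula.vars, GTerm.vars, Set.mem_union, Set.mem_singleton_iff,
        List.mem_singleton] at hx' hx2 hx0
      rcases hx' with h | h
      exacts [hx2 (hpow h), hx0 h]
  have upd : ∀ (w : ℕ → M) (a : M), ∀ x, x ∉ [1] → Function.update w 1 a x = w x := by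
    intro w a x hx
    simp at hx
    simp [hx]
  have hDep : ∀ w : ℕ → M, (sigmaFormula 1 j).Holds w ↔ ∃ k n : ℕ,
      npowRec (k + 1) (w 1) = npowRec n (w 0) ∨ npowRec (k + 1) (w 1) * npowRec n (w 0) = 1 := by
    intro w
    simp only [holds_sigmaFormula_succ, hj]
    constructor
    · rintro ⟨_, _, _, ⟨k, n, h⟩, -, w', hw', h'⟩
      obtain ⟨rfl, rfl, rfl⟩ := memberCode_inj.1 h
      obtain rfl : w' = w := funext fun x => hw' x (by simp)
      rw [holds_piFormula_zero] at h'
      simp only [dependence, Holds, GTerm.value_pow, GTerm.value] at h'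
      exact ⟨k, n, h'⟩
    · rintro ⟨k, n, h⟩
      refine ⟨_, _, _, ⟨k, n, rfl⟩, le_rfl, w, fun _ _ => rfl, ?_⟩
      rw [holds_piFormula_zero]
      simpa only [dependence, Holds, GTerm.value_pow, GTerm.value] using h
  have hNon : ∀ k (w : ℕ → M), (sigmaFormula 1 (f k)).Holds w ↔
      (npowRec k (w 1) ≠ w 0 ∨ k ∈ S) := by
    intro k w
    simp only [holds_sigmaFormula_succ, hf]
    constructor
    · rintro ⟨_, _, _, h | ⟨h, -⟩, -, w', hw', h'⟩
      · obtain ⟨rfl, rfl, rfl⟩ := memberCode_inj.1 h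
        obtain rfl : w' = w := funext fun x => hw' x (by simp)
        rw [holds_piFormula_zero] at h'
        simp only [Holds, GTerm.value_pow, GTerm.value] at h'
        exact Or.inl h'
      · exact Or.inr h
    · rintro (h | h)
      · refine ⟨_, _, _, Or.inl rfl, le_rfl, w, fun _ _ => rfl, ?_⟩
        rw [holds_piFormula_zero]
        simpa only [Holds, GTerm.value_pow, GTerm.value] using h
      · refine ⟨_, _, _, Or.inr ⟨h, rfl⟩, le_rfl, w, fun _ _ => rfl, ?_⟩
        rw [holds_piFormula_zero]
        simp only [Holds]
  have hDiv : ∀ k (w : ℕ → M), (sigmaFormula 1 (g k)).Holds w ↔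
      ∃ a : M, npowRec k a = w 0 := by
    intro k w
    simp only [holds_sigmaFormula_succ, hg]
    constructor
    · rintro ⟨_, _, _, h, -, w', hw', h'⟩
      obtain ⟨rfl, rfl, rfl⟩ := memberCode_inj.1 h
      rw [holds_piFormula_zero] at h'
      simp only [Holds, GTerm.value_pow, GTerm.value] at h'
      rw [hw' 0 (by simp)] at h'
      exact ⟨_, h'⟩
    · rintro ⟨a, h⟩
      refine ⟨_, _, _, rfl, le_rfl, Function.update w 1 a, upd w a, ?_⟩
      rw [holds_piFormula_zero]
      simpa [Holds, GTerm.value_pow, GTerm.value] using h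
  have hPi : ∀ w : ℕ → M, (piFormula 2 i).Holds w ↔ IsRankOne M (w 0) S := by
    intro w
    simp only [holds_piFormula_succ, hi]
    constructor
    · intro H
      have hlaws : ∀ a b c : M, _ := fun a b c => (holds_sigmaFormula_zero _ _).1
        (H _ _ _ (Or.inl rfl) (by simp)
          (fun n => if n = 1 then a else if n = 2 then b else if n = 3 then c else w n)
          (fun x hx => by simp at hx; simp [hx]))
      simp [abelianGroupLaws, Holds, GTerm.value] at hlaws
      have hne := (holds_sigmaFormula_zero _ _).1
        (H _ _ _ (Or.inr (Or.inl rfl)) (by simp) w fun _ _ => rfl)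
      have htf : ∀ (k : ℕ) (a : M), _ := fun k a => (holds_sigmaFormula_zero _ _).1
        (H _ _ _ (Or.inr (Or.inr (Or.inl ⟨k, rfl⟩))) (by simp) (Function.update w 1 a) (upd w a))
      simp only [torsionFreeLaw, Holds, GTerm.value_pow, GTerm.value,
        Function.update_self] at htf
      have hr : ∀ a : M, _ := fun a => (hDep _).1
        (H _ _ _ (Or.inr (Or.inr (Or.inr (Or.inl rfl)))) (by simp) (Function.update w 1 a)
          (upd w a))
      have hn : ∀ (k : ℕ) (a : M), _ := fun k a => (hNon k _).1
        (H _ _ _ (Or.inr (Or.inr (Or.inr (Or.inr (Or.inl ⟨k, rfl⟩))))) (by simp)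
          (Function.update w 1 a) (upd w a))
      have hd : ∀ (k : ℕ), k ∈ S → _ := fun k hk => (hDiv k _).1
        (H _ _ _ (Or.inr (Or.inr (Or.inr (Or.inr (Or.inr ⟨k, hk, rfl⟩))))) (by simp)
          w fun _ _ => rfl)
      simp only [Function.update_self, Function.update_of_ne (zero_ne_one' ℕ)] at hr hn
      refine ⟨fun a b c => (hlaws a b c).1.1, fun a => (hlaws a a a).1.2,
        fun a => (hlaws a a a).2.1, fun a b => (hlaws a b a).2.2, hne,
        fun k a h => (htf k a).resolve_left (not_not_intro h), hr, fun k => ⟨?_, hd k⟩⟩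
      rintro ⟨a, ha⟩
      exact (hn k a).resolve_left (not_not_intro ha)
    · rintro H m xs i (h | h | ⟨k, h⟩ | h | ⟨k, h⟩ | ⟨k, hk, h⟩) - w' hw'
      all_goals
        obtain ⟨rfl, rfl, rfl⟩ := memberCode_inj.1 h
        have h0 := hw' 0 (by simp)
      · rw [holds_sigmaFormula_zero]
        simp only [abelianGroupLaws, Holds, GTerm.value]
        exact ⟨⟨H.assoc _ _ _, H.one_mul _⟩, H.inv_mul _, H.comm _ _⟩
      · rw [holds_sigmaFormula_zero]
        simp only [Holds, GTerm.value, h0]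
        exact H.ne_one
      · rw [holds_sigmaFormula_zero]
        simp only [torsionFreeLaw, Holds, GTerm.value, GTerm.value_pow]
        exact or_iff_not_imp_left.2 fun h => H.torsionFree k _ (not_not.1 h)
      · rw [hDep, h0]
        exact H.rank _
      · rw [hNon, h0]
        exact or_iff_not_imp_left.2 fun h => (H.divides k).1 ⟨_, not_not.1 h⟩
      · rw [hDiv, h0]
        exact (H.divides k).2 hk
  rw [holds_sigmaFormula_succ]
  simp only [he]
  constructor
  · rintro ⟨_, _, _, h, -, w, -, hw⟩
    obtain ⟨rfl, rfl, rfl⟩ := memberCode_inj.1 h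
    exact ⟨_, (hPi w).1 hw⟩
  · rintro ⟨x, hx⟩
    refine ⟨_, _, _, rfl, le_rfl, Function.update v 0 x, fun y hy => ?_, (hPi _).2 ?_⟩
    · simp at hy
      simp [hy]
    · simpa using hx

theorem exists_scottSentence {G : AddSubgroup ℚ}
    (hG : IsComputablyPresented (Multiplicative G)) {u : ℚ} (huG : u ∈ G) (hu : u ≠ 0) :
    ∃ φ, IsComputableSigma 3 φ ∧ IsScottSentence φ (Multiplicative G) := by
  obtain ⟨φ, hφ, hs, h⟩ := exists_sigma3_isRankOne (S := {k | DividesIn G k u})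
    (sig1_dividesIn hG huG hu)
  refine ⟨φ, hφ, hs, fun M _ _ _ _ => ?_⟩
  rw [structIso_iff_isRankOne huG hu]
  -- The right-hand side of `h` does not mention the assignment, so any one will do.
  exact ⟨fun H => (h M fun _ => 1).1 (H _), fun H v => (h M v).2 H⟩

end ScottSentence

end InfGroup

namespace InfGroup

/-! ## `Σ⁰₃` sets and deficiency sets -/

section Sigma03

/-- The value `x` is output once for each `y` such that witnesses `z` exist for all `j < y`; this
happens infinitely often iff `∀ y, ∃ z, R (n, x, y, z)`. -/
theorem exists_limit_function {T : Set ℕ} (hT : IsSigma03 T) :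
    ∃ c : ℕ → ℕ → ℕ, (Computable fun x : ℕ × ℕ => c x.1 x.2) ∧
      ∀ n, n ∈ T ↔ ∃ x, {s | c n s = x}.Infinite := by
  classical
  obtain ⟨R, hR, h⟩ := hT
  let A : ℕ → ℕ → ℕ → ℕ → Prop := fun n x y b => ∀ j < y, ∃ z < b, R (n, x, j, z)
  have hA : ComputablePred fun q : ℕ × ℕ × ℕ × ℕ => A q.1 q.2.1 q.2.2.1 q.2.2.2 := by
    refine ComputablePred.forall_lt
      (P := fun (q : ℕ × ℕ × ℕ × ℕ) j => ∃ z < q.2.2.2, R (q.1, q.2.1, j, z)) ?_ (by fun_prop)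
    refine ComputablePred.exists_lt
      (P := fun (q : (ℕ × ℕ × ℕ × ℕ) × ℕ) z => R (q.1.1, q.1.2.1, q.2, z)) ?_ (by fun_prop)
    exact hR.comp (f := fun q : ((ℕ × ℕ × ℕ × ℕ) × ℕ) × ℕ => (q.1.1.1, q.1.1.2.1, q.1.2, q.2))
      (by fun_prop)
  -- The stage `s` codes `(x, y, b)` and counts when `b` is the least bound for the witnesses below
  -- `y`. As `A` is monotone in `b`, each pair `(x, y)` counts at most once.
  let g : ℕ → ℕ → Prop := fun n s =>
    A n s.unpair.1 s.unpair.2.unpair.1 s.unpair.2.unpair.2 ∧ (s.unpair.2.unpair.2 = 0 ∨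
      ¬ A n s.unpair.1 s.unpair.2.unpair.1 (s.unpair.2.unpair.2 - 1))
  have hg : ComputablePred fun q : ℕ × ℕ => g q.1 q.2 := by
    refine ComputablePred.and (hA.comp (f := fun q : ℕ × ℕ =>
      (q.1, q.2.unpair.1, q.2.unpair.2.unpair.1, q.2.unpair.2.unpair.2)) (by fun_prop))
      (ComputablePred.or (by fun_prop) (hA.comp (f := fun q : ℕ × ℕ =>
      (q.1, q.2.unpair.1, q.2.unpair.2.unpair.1, q.2.unpair.2.unpair.2 - 1)) (by fun_prop)).not)
  -- The default output `s` adds at most one occurrence of each value, namely at stage `s = x`.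
  refine ⟨fun n s => if g n s then s.unpair.1 else s,
    Computable.ite_comp hg (by fun_prop) (by fun_prop), fun n => ?_⟩
  rw [h]
  refine exists_congr fun x => ⟨fun H => ?_, fun H j => ?_⟩
  · have hb : ∀ y, ∃ b, A n x y b ∧ (b = 0 ∨ ¬ A n x y (b - 1)) := by
      intro y
      have hex : ∃ b, A n x y b := by
        choose z hz using H
        exact ⟨(Finset.range y).sup z + 1, fun j hj => ⟨z j, Nat.lt_succ_of_le
          (Finset.le_sup (Finset.mem_range.2 hj)), hz j⟩⟩
      refine ⟨Nat.find hex, Nat.find_spec hex, ?_⟩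
      by_cases h0 : Nat.find hex = 0
      · exact Or.inl h0
      · exact Or.inr (Nat.find_min hex (by omega))
    choose b hb using hb
    refine Set.infinite_of_injective_forall_mem (f := fun y => Nat.pair x (Nat.pair y (b y)))
      (fun y y' hy => ?_) fun y => ?_
    · simpa using (Nat.pair_eq_pair.1 (Nat.pair_eq_pair.1 hy).2).1
    · have : g n (Nat.pair x (Nat.pair y (b y))) := by simpa [g] using hb y
      simp [this]
  · have hinf : {s | g n s ∧ s.unpair.1 = x}.Infinite := by
      refine (H.sdiff (Set.finite_singleton x)).mono ?_
      rintro s ⟨hs, hsx⟩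
      by_cases hgs : g n s
      · exact ⟨hgs, by simpa [hgs] using hs⟩
      · exact absurd (by simpa [hgs] using hs) hsx
    have hinj : Set.InjOn (fun s : ℕ => s.unpair.2.unpair.1) {s | g n s ∧ s.unpair.1 = x} := by
      have mono : ∀ {y b b'}, b ≤ b' → A n x y b → A n x y b' := fun hb H j hj => by
        obtain ⟨z, hz, hr⟩ := H j hj
        exact ⟨z, hz.trans_le hb, hr⟩
      rintro s ⟨⟨h1, h2⟩, hx⟩ s' ⟨⟨h1', h2'⟩, hx'⟩ (e : s.unpair.2.unpair.1 = s'.unpair.2.unpair.1)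
      rw [hx] at h1 h2
      rw [hx', ← e] at h1' h2'
      have : s.unpair.2.unpair.2 = s'.unpair.2.unpair.2 := by
        rcases lt_trichotomy s.unpair.2.unpair.2 s'.unpair.2.unpair.2 with hlt | heq | hlt
        · exact absurd (mono (by omega) h1) (h2'.resolve_left (by omega))
        · exact heq
        · exact absurd (mono (by omega) h1') (h2.resolve_left (by omega))
      rw [← Nat.pair_unpair s, ← Nat.pair_unpair s', ← Nat.pair_unpair s.unpair.2,
        ← Nat.pair_unpair s'.unpair.2, hx, hx', e, this]
    obtain ⟨_, ⟨s, ⟨⟨h1, -⟩, rfl⟩, rfl⟩, hj⟩ := (hinf.image hinj).exists_gt j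
    obtain ⟨z, -, hz⟩ := h1 j hj
    exact ⟨z, hz⟩

/-- If every value occurs finitely often, the last occurrence of the least value taken after `N` is
a true stage beyond `N`. Conversely, let `v` be the least value occurring infinitely often: a true
stage has a value below `v`, and such values occur only finitely often. -/
theorem finite_trueStages_iff (c : ℕ → ℕ) :
    {i | ∀ s > i, c i < c s}.Finite ↔ ∃ x, {s | c s = x}.Infinite := by
  classical
  constructor
  · contrapose!
    intro H
    refine Set.infinite_of_forall_exists_gt fun N => ?_
    have hex : ∃ v, ∃ s > N, c s = v := ⟨_, N + 1, N.lt_succ_self, rfl⟩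
    obtain ⟨i, ⟨hi, hiN⟩, hmax⟩ := Set.exists_max_image {s | c s = Nat.find hex ∧ s > N} id
      ((H (Nat.find hex)).subset fun s hs => hs.1)
      (by obtain ⟨s, hs, h⟩ := Nat.find_spec hex; exact ⟨s, h, hs⟩)
    refine ⟨i, fun s hs => ?_, hiN⟩
    have hsN : s > N := hiN.trans hs
    have hle : Nat.find hex ≤ c s := Nat.find_min' hex ⟨s, hsN, rfl⟩
    rw [hi]
    refine lt_of_le_of_ne hle fun h => ?_
    exact absurd (hmax s ⟨h.symm, hsN⟩) (not_le.2 hs)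
  · intro hex
    have hlt : {s | c s < Nat.find hex}.Finite := by
      have : {s | c s < Nat.find hex} = ⋃ x ∈ Set.Iio (Nat.find hex), {s | c s = x} := by
        ext s; simp
      rw [this]
      exact (Set.finite_Iio _).biUnion fun x hx => Set.not_infinite.1 (Nat.find_min hex hx)
    refine hlt.subset fun i hi => ?_
    obtain ⟨s, hs, his⟩ := (Nat.find_spec hex).exists_gt i
    exact (hi s his).trans_eq hs

end Sigma03

/-! ## Uniformly computable presentations of subgroups -/

section Presentation

theorem mem_atomicDiagram_iff (B : NatStructure) (n : ℕ) : n ∈ B.atomicDiagram ↔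
    (n % 4 = 0 ∧ B.Sat (.eq (Denumerable.ofNat GTerm (n / 4).unpair.1)
      (Denumerable.ofNat GTerm (n / 4).unpair.2))) ∨
    (n % 4 = 1 ∧ B.Sat (.ne (Denumerable.ofNat GTerm (n / 4).unpair.1)
      (Denumerable.ofNat GTerm (n / 4).unpair.2))) := by
  rw [B.mem_atomicDiagram, QFFormula.ofNat]
  split_ifs with h0 h1 h2
  · simp only [h0, true_and, zero_ne_one, false_and, or_false]; rfl
  · simp only [h1, true_and, one_ne_zero, false_and, false_or]; rfl
  · simp [h0, h1, B.sat_iff, QFFormula.IsLiteral]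
  · simp [h0, h1, B.sat_iff, QFFormula.IsLiteral]

/-- The diagram determines the carrier through the sentences `n = n`, and the operations through the
sentences equating a term with a constant. -/
theorem structIso_of_atomicDiagram_eq {B B' : NatStructure}
    (h : B.atomicDiagram = B'.atomicDiagram) : StructIso B.carrier B'.carrier := by
  have hs : ∀ φ, B.Sat φ ↔ B'.Sat φ := fun φ => by rw [NatStructure.Sat, h, NatStructure.Sat]
  have hC : B.carrier = B'.carrier := by
    ext n
    simpa [NatStructure.sat_self_iff, GTerm.vars] using hs (.eq (.var n) (.var n))
  have ha : ∀ b : B.carrier, B'.assign b = Equiv.setCongr hC b := fun b =>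
    B'.assign_of_mem (hC ▸ b.2)
  have key : ∀ (t : GTerm) (b : B.carrier), t.vars ⊆ B.carrier → t.value B.assign = b →
      Equiv.setCongr hC b = t.value B'.assign := by
    intro t b ht hb
    have := (hs (.eq t (.var b))).1 ((B.sat_eq_iff _ _).2 ⟨⟨ht, by simp [GTerm.vars]⟩, by
      rw [hb, GTerm.value, B.assign_coe]⟩)
    rw [((B'.sat_eq_iff _ _).1 this).2, GTerm.value, ha]
  refine ⟨Equiv.setCongr hC, fun a b => ?_, fun a => ?_, ?_⟩
  · rw [key (.mul (.var a) (.var b)) _ (by simp [GTerm.vars, Set.insert_subset_iff])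
      (by simp only [GTerm.value, B.assign_coe])]
    simp only [GTerm.value, ha]
  · rw [key (.inv (.var a)) _ (by simp [GTerm.vars]) (by simp only [GTerm.value, B.assign_coe])]
    simp only [GTerm.value, ha]
  · rw [key .one _ (by simp [GTerm.vars]) (by simp only [GTerm.value])]
    simp only [GTerm.value]

theorem computablePred_of_finite {F : Set ℕ} (hF : F.Finite) :
    ComputablePred fun n => n ∈ F := by
  induction F, hF using Set.Finite.induction_on with
  | empty => exact ComputablePred.const False
  | @insert a s _ _ ih =>
    exact (ComputablePred.or (p := fun n => n = a) (by fun_prop) ih).of_eq fun n => by simp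

/-- An embedding of `B` into the additive group of the rational numbers. -/
structure IsRatEmbedding (B : NatStructure) (θ : B.carrier → ℚ) : Prop where
  injective : Function.Injective θ
  map_mul : ∀ a b, θ (a * b) = θ a + θ b
  map_inv : ∀ a, θ a⁻¹ = - θ a
  map_one : θ 1 = 0

theorem IsRatEmbedding.map_npowRec {B : NatStructure} {θ : B.carrier → ℚ}
    (hθ : IsRatEmbedding B θ) (k : ℕ) (a : B.carrier) : θ (npowRec k a) = k • θ a := by
  induction k with
  | zero => simp [npowRec, hθ.map_one]
  | succ k ih => rw [npowRec, hθ.map_mul, ih, succ_nsmul]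

/-- An element is represented by the pair of its name `b` in `B` and the first stage at which `b` is
seen to lie in `H`. Such pairs can be decided even though `H` is only enumerated, and each element
has exactly one. -/
theorem exists_presentation {B : NatStructure} {θ : B.carrier → ℚ} (hθ : IsRatEmbedding B θ)
    (H : AddSubgroup ℚ) {R : ℕ → ℕ → Prop}
    (hR : ∀ b, (∃ s, R b s) ↔ ∃ h : b ∈ B.carrier, θ ⟨b, h⟩ ∈ H) (hH : ∀ x ∈ H, ∃ b, θ b = x) :
    ∃ (B' : NatStructure) (e : B'.carrier ≃ Multiplicative H),
      B'.carrier = {c | R c.unpair.1 c.unpair.2 ∧ ∀ s < c.unpair.2, ¬ R c.unpair.1 s} ∧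
      (∀ c, ((e c).toAdd : ℚ) = θ (B.assign (c : ℕ).unpair.1)) ∧
      (∀ a b, e (a * b) = e a * e b) ∧ (∀ a, e a⁻¹ = (e a)⁻¹) ∧ e 1 = 1 := by
  classical
  let C : Set ℕ := {c | R c.unpair.1 c.unpair.2 ∧ ∀ s < c.unpair.2, ¬ R c.unpair.1 s}
  have hC : ∀ c : C, ∃ h : (c : ℕ).unpair.1 ∈ B.carrier, θ ⟨_, h⟩ ∈ H := fun c =>
    (hR _).1 ⟨_, c.2.1⟩
  have hCH : ∀ c : C, θ (B.assign (c : ℕ).unpair.1) ∈ H := fun c => by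
    obtain ⟨h, hc⟩ := hC c
    rwa [B.assign_of_mem h]
  let g : C → Multiplicative H := fun c => Multiplicative.ofAdd ⟨_, hCH c⟩
  have hg : Function.Bijective g := by
    constructor
    · intro c c' h
      have h' := hθ.injective (congrArg Subtype.val (Multiplicative.ofAdd.injective h))
      obtain ⟨hc, -⟩ := hC c
      obtain ⟨hc', -⟩ := hC c'
      rw [B.assign_of_mem hc, B.assign_of_mem hc', Subtype.mk.injEq] at h'
      have h1 := c.2
      have h2 := c'.2
      simp only [C, Set.mem_ofPred_eq, ← h'] at h1 h2
      apply Subtype.ext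
      rw [← Nat.pair_unpair c, ← Nat.pair_unpair c', h']
      congr 1
      rcases lt_trichotomy (c : ℕ).unpair.2 (c' : ℕ).unpair.2 with h | h | h
      · exact absurd h1.1 (h2.2 _ h)
      · exact h
      · exact absurd h2.1 (h1.2 _ h)
    · intro x
      obtain ⟨b, hb⟩ := hH _ x.toAdd.2
      have hex := (hR b).2 ⟨b.2, by rw [Subtype.coe_eta, hb]; exact x.toAdd.2⟩
      refine ⟨⟨Nat.pair b (Nat.find hex), ?_⟩, ?_⟩
      · simp only [C, Set.mem_ofPred_eq, Nat.unpair_pair]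
        exact ⟨Nat.find_spec hex, fun s hs => Nat.find_min hex hs⟩
      · apply Multiplicative.toAdd.injective
        apply Subtype.ext
        simp [g, B.assign_coe, hb]
  let e := Equiv.ofBijective g hg
  refine ⟨⟨C, fun a b => e.symm (e a * e b), fun a => e.symm (e a)⁻¹, e.symm 1⟩, e, rfl,
    fun c => rfl, fun a b => ?_, fun a => ?_, ?_⟩
  · exact e.apply_symm_apply _
  · exact e.apply_symm_apply _
  · exact e.apply_symm_apply _

-- Translating terms over the copy into terms over `B`

section Rename

variable {B B' : NatStructure} {θ : B.carrier → ℚ} {H : AddSubgroup ℚ}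
  {e : B'.carrier → Multiplicative H} {c : ℕ → Option ℕ}

theorem rename_eq_none (hc : ∀ n, n ∉ B'.carrier → c n = none) {t : GTerm}
    (ht : ¬ t.vars ⊆ B'.carrier) : t.rename c = none := by
  induction t with
  | one => simp [GTerm.vars] at ht
  | var n => rw [GTerm.rename, hc n (by simpa [GTerm.vars] using ht), Option.map_none]
  | inv t ih => rw [GTerm.rename, ih ht, Option.map_none]
  | mul s t ihs iht =>
    rw [GTerm.vars, Set.union_subset_iff, not_and_or] at ht
    rcases ht with ht | ht
    · rw [GTerm.rename, ihs ht, Option.bind_none]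
    · rw [GTerm.rename, iht ht]; simp

theorem exists_rename_eq_some (hθ : IsRatEmbedding B θ)
    (hc : ∀ n, n ∈ B'.carrier → c n = some n.unpair.1 ∧ n.unpair.1 ∈ B.carrier)
    (he : ∀ c, ((e c).toAdd : ℚ) = θ (B.assign (c : ℕ).unpair.1))
    (hm : ∀ a b, e (a * b) = e a * e b) (hi : ∀ a, e a⁻¹ = (e a)⁻¹) (h1 : e 1 = 1)
    {t : GTerm} (ht : t.vars ⊆ B'.carrier) :
    ∃ t', t.rename c = some t' ∧ t'.vars ⊆ B.carrier ∧
      θ (t'.value B.assign) = (e (t.value B'.assign)).toAdd := by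
  induction t with
  | one => exact ⟨_, rfl, by simp [GTerm.vars], by simp [GTerm.value, h1, hθ.map_one]⟩
  | var n =>
    have hn : n ∈ B'.carrier := by simpa [GTerm.vars] using ht
    obtain ⟨h, hn'⟩ := hc n hn
    refine ⟨.var n.unpair.1, by rw [GTerm.rename, h, Option.map_some],
      by simpa [GTerm.vars] using hn', ?_⟩
    rw [GTerm.value, GTerm.value, B'.assign_of_mem hn, he]
  | inv t ih =>
    obtain ⟨t', h, hv, hval⟩ := ih ht
    exact ⟨.inv t', by rw [GTerm.rename, h, Option.map_some], hv, by
      simp [GTerm.value, hθ.map_inv, hval, hi]⟩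
  | mul s t ihs iht =>
    rw [GTerm.vars, Set.union_subset_iff] at ht
    obtain ⟨s', h, hv, hval⟩ := ihs ht.1
    obtain ⟨t', h', hv', hval'⟩ := iht ht.2
    exact ⟨.mul s' t', by rw [GTerm.rename, h, h', Option.bind_some, Option.map_some],
      Set.union_subset hv hv', by simp [GTerm.value, hθ.map_mul, hval, hval', hm]⟩

end Rename

/-- A literal over `B' n` is decided by translating both terms to `B` and consulting the diagram of
`B`. -/
theorem computablePred_atomicDiagram_of_rename {B : NatStructure} (hB : B.IsComputable)
    {B' : ℕ → NatStructure} {c : ℕ → ℕ → Option ℕ} (hc : Computable fun x : ℕ × ℕ => c x.1 x.2)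
    (hEq : ∀ n s t, (B' n).Sat (.eq s t) ↔ s.rename (c n) ≠ none ∧ t.rename (c n) ≠ none ∧
      B.Sat (.eq ((s.rename (c n)).getD .one) ((t.rename (c n)).getD .one)))
    (hNe : ∀ n s t, (B' n).Sat (.ne s t) ↔ s.rename (c n) ≠ none ∧ t.rename (c n) ≠ none ∧
      B.Sat (.ne ((s.rename (c n)).getD .one) ((t.rename (c n)).getD .one))) :
    ComputablePred fun x : ℕ × ℕ => x.2 ∈ (B' x.1).atomicDiagram := by
  have hren : Computable fun x : ℕ × GTerm => x.2.rename (c x.1) := Computable.gtermRename hc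
  -- The default `.one` is harmless: a failed translation is excluded by the conditions `≠ none`.
  have hget : Computable fun x : ℕ × GTerm => (x.2.rename (c x.1)).getD .one :=
    Computable.option_getD hren (by fun_prop)
  have hnone : ComputablePred fun x : ℕ × GTerm => x.2.rename (c x.1) ≠ none :=
    (ComputablePred.eq hren (Computable.const none)).not
  let l : ℕ × ℕ → ℕ × GTerm := fun x => (x.1, Denumerable.ofNat GTerm (x.2 / 4).unpair.1)
  let r : ℕ × ℕ → ℕ × GTerm := fun x => (x.1, Denumerable.ofNat GTerm (x.2 / 4).unpair.2)
  have hl : Computable l := by fun_prop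
  have hr : Computable r := by fun_prop
  have hgl := hget.comp hl
  have hgr := hget.comp hr
  have hE := hB.sat.comp (Computable.qfEq hgl hgr)
  have hN := hB.sat.comp (Computable.qfNe hgl hgr)
  have hnl := hnone.comp hl
  have hnr := hnone.comp hr
  have h0 : ComputablePred fun x : ℕ × ℕ => x.2 % 4 = 0 := by fun_prop
  have h1 : ComputablePred fun x : ℕ × ℕ => x.2 % 4 = 1 := by fun_prop
  refine ((h0.and (hnl.and (hnr.and hE))).or (h1.and (hnl.and (hnr.and hN)))).of_eq fun x => ?_
  rw [mem_atomicDiagram_iff, hEq, hNe]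

/-- Restricting names to the decidable carrier of `B' n` makes renaming succeed exactly on terms
over `B' n`; the embedding `θ` shows that it preserves and reflects equality of values. -/
theorem exists_uniform_presentation {B : NatStructure} (hB : B.IsComputable)
    {θ : B.carrier → ℚ} (hθ : IsRatEmbedding B θ) (H : ℕ → AddSubgroup ℚ)
    (hH : ∀ n, ∀ x ∈ H n, ∃ b, θ b = x)
    (hsig : Sig1 fun x : ℕ × ℕ => ∃ h : x.2 ∈ B.carrier, θ ⟨x.2, h⟩ ∈ H x.1) :
    ∃ B' : ℕ → NatStructure, (ComputablePred fun x : ℕ × ℕ => x.2 ∈ (B' x.1).atomicDiagram) ∧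
      ∀ n, StructIso (B' n).carrier (Multiplicative (H n)) := by
  classical
  obtain ⟨R, hR, hRH⟩ := hsig
  choose B' e hC he hm hi h1 using fun n =>
    exists_presentation hθ (H n) (R := fun b s => R (n, b) s) (fun b => (hRH (n, b)).symm) (hH n)
  refine ⟨B', ?_, fun n => ⟨e n, hm n, hi n, h1 n⟩⟩
  have hCc : ComputablePred fun x : ℕ × ℕ => x.2 ∈ (B' x.1).carrier := by
    have h : ComputablePred fun x : ℕ × ℕ => R (x.1, x.2.unpair.1) x.2.unpair.2 ∧
        ∀ s < x.2.unpair.2, ¬ R (x.1, x.2.unpair.1) s := by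
      refine ComputablePred.and (hR.comp (f := fun x : ℕ × ℕ =>
        ((x.1, x.2.unpair.1), x.2.unpair.2)) (by fun_prop)) ?_
      refine ComputablePred.forall_lt (P := fun (x : ℕ × ℕ) s => ¬ R (x.1, x.2.unpair.1) s)
        (hR.not.comp (f := fun x : (ℕ × ℕ) × ℕ => ((x.1.1, x.1.2.unpair.1), x.2))
        (by fun_prop)) (by fun_prop)
    exact h.of_eq fun x => by rw [hC]; rfl
  let c : ℕ → ℕ → Option ℕ := fun n k => if k ∈ (B' n).carrier then some k.unpair.1 else none
  have hc : Computable fun x : ℕ × ℕ => c x.1 x.2 :=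
    Computable.ite_comp hCc (by fun_prop) (by fun_prop)
  have hnone : ∀ n (t : GTerm), ¬ t.vars ⊆ (B' n).carrier → t.rename (c n) = none := fun n t ht =>
    rename_eq_none (fun k hk => by simp [c, hk]) ht
  have hsome : ∀ n (t : GTerm), t.vars ⊆ (B' n).carrier → ∃ t', t.rename (c n) = some t' ∧
      t'.vars ⊆ B.carrier ∧ θ (t'.value B.assign) = (e n (t.value (B' n).assign)).toAdd :=
    fun n t ht => exists_rename_eq_some hθ (fun k hk => ⟨by simp [c, hk], by
      rw [hC] at hk
      exact ((hRH _).2 ⟨_, hk.1⟩).1⟩) (he n) (hm n) (hi n) (h1 n) ht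
  have hval : ∀ n (s t : GTerm), (s.vars ⊆ (B' n).carrier ∧ t.vars ⊆ (B' n).carrier) →
      ∃ s' t', s.rename (c n) = some s' ∧ t.rename (c n) = some t' ∧
      (s'.vars ⊆ B.carrier ∧ t'.vars ⊆ B.carrier) ∧ (s'.value B.assign = t'.value B.assign ↔
        s.value (B' n).assign = t.value (B' n).assign) := by
    rintro n s t ⟨hs, ht⟩
    obtain ⟨s', hs', hsv, hsval⟩ := hsome n s hs
    obtain ⟨t', ht', htv, htval⟩ := hsome n t ht
    refine ⟨s', t', hs', ht', ⟨hsv, htv⟩, ?_⟩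
    rw [← hθ.injective.eq_iff, hsval, htval, Subtype.coe_inj, EmbeddingLike.apply_eq_iff_eq,
      (e n).injective.eq_iff]
  have hEq : ∀ n s t, (B' n).Sat (.eq s t) ↔ s.rename (c n) ≠ none ∧ t.rename (c n) ≠ none ∧
      B.Sat (.eq ((s.rename (c n)).getD .one) ((t.rename (c n)).getD .one)) := by
    intro n s t
    by_cases hv : s.vars ⊆ (B' n).carrier ∧ t.vars ⊆ (B' n).carrier
    · obtain ⟨s', t', hs, ht, hv', h⟩ := hval n s t hv
      simp [hs, ht, NatStructure.sat_eq_iff, hv, hv', h]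
    · refine iff_of_false (fun h => hv ((NatStructure.sat_eq_iff _ _ _).1 h).1) fun h => hv ?_
      exact ⟨by_contra fun hs => h.1 (hnone n s hs), by_contra fun ht => h.2.1 (hnone n t ht)⟩
  have hNe : ∀ n s t, (B' n).Sat (.ne s t) ↔ s.rename (c n) ≠ none ∧ t.rename (c n) ≠ none ∧
      B.Sat (.ne ((s.rename (c n)).getD .one) ((t.rename (c n)).getD .one)) := by
    intro n s t
    by_cases hv : s.vars ⊆ (B' n).carrier ∧ t.vars ⊆ (B' n).carrier
    · obtain ⟨s', t', hs, ht, hv', h⟩ := hval n s t hv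
      simp [hs, ht, NatStructure.sat_ne_iff, hv, hv', h]
    · refine iff_of_false (fun h => hv ((NatStructure.sat_ne_iff _ _ _).1 h).1) fun h => hv ?_
      exact ⟨by_contra fun hs => h.1 (hnone n s hs), by_contra fun ht => h.2.1 (hnone n t ht)⟩
  exact computablePred_atomicDiagram_of_rename hB hc hEq hNe

end Presentation

/-! ## Hardness -/

section Hardness

/-- In the criterion of `mem_divisibleBy_iff` the set `Q n` occurs only as `p ∉ Q n`, which is
`Σ⁰₁`, and under a bounded quantifier. -/
theorem sig1_mem_divisibleBy {G : AddSubgroup ℚ} {u : ℚ} (hu : u ≠ 0)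
    {B : NatStructure} (hB : B.IsComputable) {θ : B.carrier → ℚ} (hθ : IsRatEmbedding B θ)
    (hG : ∀ x, x ∈ G ↔ ∃ b, θ b = x) (huG : u ∈ G) (Q : ℕ → Set ℕ)
    (hQ : ∀ n, ∀ p ∈ Q n, p.Prime ∧ DividesIn G p u)
    (hQs : Sig1 fun x : ℕ × ℕ => x.2 ∉ Q x.1) :
    Sig1 fun x : ℕ × ℕ => ∃ h : x.2 ∈ B.carrier, θ ⟨x.2, h⟩ ∈ divisibleBy G (Q x.1) := by
  obtain ⟨y, hy⟩ := (hG u).1 huG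
  have h : Sig1 fun x : ℕ × ℕ => x.2 ∈ B.carrier ∧ ∃ d n : ℕ,
      (B.Sat (.eq ((GTerm.var x.2).pow (d + 1)) ((GTerm.var y).pow n)) ∨
      B.Sat (.eq (.mul ((GTerm.var x.2).pow (d + 1)) ((GTerm.var y).pow n)) .one)) ∧
      ∀ p < d + 2, ¬ p ∣ d + 1 ∨ p ∉ Q x.1 ∨ ∃ a : B.carrier, npowRec p a = B.assign x.2 := by
    refine .and (hB.mem_carrier.comp (by fun_prop)).sig1 ?_
    refine Sig1.ex (P := fun (x : ℕ × ℕ) (d : ℕ) => ∃ n : ℕ,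
      (B.Sat (.eq ((GTerm.var x.2).pow (d + 1)) ((GTerm.var y).pow n)) ∨
      B.Sat (.eq (.mul ((GTerm.var x.2).pow (d + 1)) ((GTerm.var y).pow n)) .one)) ∧
      ∀ p < d + 2, ¬ p ∣ d + 1 ∨ p ∉ Q x.1 ∨ ∃ a : B.carrier, npowRec p a = B.assign x.2) ?_
    refine Sig1.ex (P := fun (x : (ℕ × ℕ) × ℕ) (n : ℕ) =>
      (B.Sat (.eq ((GTerm.var x.1.2).pow (x.2 + 1)) ((GTerm.var y).pow n)) ∨
      B.Sat (.eq (.mul ((GTerm.var x.1.2).pow (x.2 + 1)) ((GTerm.var y).pow n)) .one)) ∧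
      ∀ p < x.2 + 2, ¬ p ∣ x.2 + 1 ∨ p ∉ Q x.1.1 ∨
        ∃ a : B.carrier, npowRec p a = B.assign x.1.2) ?_
    refine .and (.or (hB.sat.comp (by fun_prop)).sig1 (hB.sat.comp (by fun_prop)).sig1) ?_
    refine Sig1.forall_lt (P := fun (x : ((ℕ × ℕ) × ℕ) × ℕ) p => ¬ p ∣ x.1.2 + 1 ∨
      p ∉ Q x.1.1.1 ∨ ∃ a : B.carrier, npowRec p a = B.assign x.1.1.2) ?_ (by fun_prop)
    refine .or (ComputablePred.sig1 (by fun_prop)) (.or ?_ ?_)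
    · exact hQs.comp (f := fun x : (((ℕ × ℕ) × ℕ) × ℕ) × ℕ => (x.1.1.1.1, x.2)) (by fun_prop)
    · exact (sig1_exists_npowRec hB).comp
        (f := fun x : (((ℕ × ℕ) × ℕ) × ℕ) × ℕ => (x.2, x.1.1.1.2)) (by fun_prop)
  refine h.of_eq fun x => ?_
  rw [← exists_prop]
  refine exists_congr fun hx => ?_
  rw [mem_divisibleBy_iff hu (hQ x.1) ((hG _).2 ⟨_, rfl⟩)]
  have hvx : ∀ k, ((GTerm.var x.2).pow k).vars ⊆ B.carrier := fun k => B.vars_pow_var k ⟨x.2, hx⟩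
  refine exists_congr fun d => exists_congr fun n => and_congr (or_congr ?_ ?_)
    (forall_congr' fun p => forall_congr' fun hp => ?_)
  · rw [B.sat_eq_iff, and_iff_right ⟨hvx _, B.vars_pow_var _ _⟩, B.value_pow_var,
      B.value_pow_var (d + 1) ⟨x.2, hx⟩, ← hθ.injective.eq_iff, hθ.map_npowRec, hθ.map_npowRec, hy]
  · rw [B.sat_eq_iff, and_iff_right ⟨Set.union_subset (hvx _) (B.vars_pow_var _ _),
      by simp [GTerm.vars]⟩, GTerm.value, GTerm.value, B.value_pow_var,
      B.value_pow_var (d + 1) ⟨x.2, hx⟩, ← hθ.injective.eq_iff, hθ.map_mul, hθ.map_npowRec,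
      hθ.map_npowRec, hy, hθ.map_one]
  · have : (∃ a : B.carrier, npowRec p a = B.assign x.2) ↔ DividesIn G p (θ ⟨x.2, hx⟩) := by
      rw [B.assign_of_mem hx]
      constructor
      · rintro ⟨a, ha⟩
        exact ⟨θ a, (hG _).2 ⟨a, rfl⟩, by rw [← hθ.map_npowRec, ha]⟩
      · rintro ⟨z, hz, h⟩
        obtain ⟨a, rfl⟩ := (hG z).1 hz
        exact ⟨a, hθ.injective (by rw [hθ.map_npowRec, h])⟩
    rw [this]
    tauto

theorem manyOneReducible_indexSet {G : AddSubgroup ℚ}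
    (hG : IsComputablyPresented (Multiplicative G)) {u : ℚ} (huG : u ∈ G) (hu : u ≠ 0)
    (hzero : (primesZero G u).Finite) (hinf : (primesInf G u).Finite) {T : Set ℕ}
    (hT : IsSigma03 T) :
    ManyOneReducible (fun n => n ∈ T) (fun n => n ∈ indexSet (Multiplicative G)) := by
  obtain ⟨c, hc, hcT⟩ := exists_limit_function hT
  obtain ⟨B, hB, f, hm, hi, h1⟩ := hG
  let θ : B.carrier → ℚ := fun b => ((f b).toAdd : G)
  have hθ : IsRatEmbedding B θ := ⟨fun a b h => f.injective (Multiplicative.toAdd.injective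
    (Subtype.ext h)), fun a b => by simp [θ, hm], fun a => by simp [θ, hi], by simp [θ, h1]⟩
  have hθG : ∀ x, x ∈ G ↔ ∃ b, θ b = x := by
    refine fun x => ⟨fun hx => ⟨f.symm (Multiplicative.ofAdd ⟨x, hx⟩), by simp [θ]⟩, ?_⟩
    rintro ⟨b, rfl⟩
    exact SetLike.coe_mem _
  let I : ℕ → Set ℕ := fun n => {i | ∀ s > i, c n i < c n s}
  -- Leaving out the finite set `primesZero G u` ensures that every prime of `Q n` divides `u`, as
  -- the membership criterion requires.
  let Q : ℕ → Set ℕ := fun n => {p | p.Prime ∧ p ∉ primesZero G u ∧ p.primeCounting' ∈ I n}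
  have hQ : ∀ n, ∀ p ∈ Q n, p.Prime ∧ DividesIn G p u := fun n p hp =>
    ⟨hp.1, by_contra fun h => hp.2.1 ⟨hp.1, h⟩⟩
  have hQs : Sig1 fun x : ℕ × ℕ => x.2 ∉ Q x.1 := by
    have h : Sig1 fun x : ℕ × ℕ => ¬ x.2.Prime ∨ x.2 ∈ primesZero G u ∨
        ∃ s, s > x.2.primeCounting' ∧ c x.1 s ≤ c x.1 x.2.primeCounting' := by
      refine .or (computablePred_prime.comp (by fun_prop)).not.sig1
        (.or ((computablePred_of_finite hzero).comp (by fun_prop)).sig1 ?_)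
      refine Sig1.ex (P := fun (x : ℕ × ℕ) s => s > x.2.primeCounting' ∧
        c x.1 s ≤ c x.1 x.2.primeCounting') (ComputablePred.sig1 (.and ?_ ?_))
      · exact ComputablePred.lt (computable_primeCounting'.comp (by fun_prop)) (by fun_prop)
      · refine ComputablePred.le
          (hc.comp (g := fun x : (ℕ × ℕ) × ℕ => (x.1.1, x.2)) (by fun_prop)) ?_
        refine hc.comp (g := fun x : (ℕ × ℕ) × ℕ => (x.1.1, x.1.2.primeCounting')) ?_
        exact Computable.pair (by fun_prop) (computable_primeCounting'.comp (by fun_prop))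
    refine h.of_eq fun x => ?_
    simp only [Q, I, Set.mem_ofPred_eq, not_and_or, not_forall, not_not, not_lt, exists_prop]
  obtain ⟨B', hB', hiso⟩ := exists_uniform_presentation hB hθ (fun n => divisibleBy G (Q n))
    (fun n x hx => (hθG x).1 hx.1) (sig1_mem_divisibleBy hu hB hθ hθG huG Q hQ hQs)
  obtain ⟨r, hr, hrB⟩ := ComputablePred.exists_index (P := fun n m => m ∈ (B' n).atomicDiagram) hB'
  refine ⟨r, hr, fun n => ?_⟩
  refine ((hcT n).trans (finite_trueStages_iff _).symm).trans ?_
  constructor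
  · intro hfin
    have hQfin : (Q n).Finite := (hfin.image (Nat.nth Nat.Prime)).subset fun p hp =>
      ⟨_, hp.2.2, by rw [Nat.primeCounting', Nat.nth_count hp.1]⟩
    exact ⟨B' n, (hiso n).trans (structIso_divisibleBy (fun p hp => hp.1) hQfin).symm,
      fun m => hrB n m⟩
  · rintro ⟨B₁, hB₁, hB₁r⟩
    by_contra hI
    -- The index `r n` fixes the diagram, so any other structure with that diagram is isomorphic to
    -- `B' n`.
    have hdiag : B₁.atomicDiagram = (B' n).atomicDiagram := by
      ext m
      have := (hB₁r m).symm.trans (hrB n m)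
      have := Part.some_injective this
      by_cases h1 : m ∈ B₁.atomicDiagram <;> by_cases h2 : m ∈ (B' n).atomicDiagram <;>
        simp_all
    refine not_structIso_divisibleBy huG hu (Q := Q n) ?_
      ((hB₁.symm.trans (structIso_of_atomicDiagram_eq hdiag)).trans (hiso n))
    have hinj := Nat.nth_injective Nat.infinite_setOfPred_prime
    -- Infinitely many true stages give infinitely many primes; outside `primesZero` and `primesInf`
    -- these lie in `primesFin`.
    refine (((Set.Infinite.image hinj.injOn hI).sdiff hzero).sdiff hinf).mono ?_
    rintro _ ⟨⟨⟨i, hi, rfl⟩, hp0⟩, hpi⟩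
    have hp := Nat.prime_nth_prime i
    refine ⟨⟨hp, hp0, by rwa [Nat.primeCounting'_nth_eq]⟩, hp, ?_⟩
    have hp1 : DividesIn G (Nat.nth Nat.Prime i ^ 1) u := by
      rw [pow_one]; exact by_contra fun h => hp0 ⟨hp, h⟩
    by_contra hno
    push Not at hno
    refine hpi ⟨hp, fun k hk => ?_⟩
    -- If no positive power of the prime were the last one dividing `u`, all powers would divide it.
    induction k, hk using Nat.le_induction with
    | base => exact hp1
    | succ k hk ih => exact hno k hk ih

end Hardness

end InfGroup

namespace InfGroup

/-! ## Recognizing atomic diagrams -/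

/-- `D` has the closure properties of an atomic diagram. -/
structure IsDiagram (D : QFFormula → Prop) : Prop where
  literal : ∀ φ, D φ → φ.toNat % 4 < 2
  one : D (.eq .one .one)
  mul : ∀ s t, D (.eq (.mul s t) (.mul s t)) → D (.eq s s) ∧ D (.eq t t)
  inv : ∀ t, D (.eq (.inv t) (.inv t)) → D (.eq t t)
  symm : ∀ s t, D (.eq s t) → D (.eq t s)
  trans : ∀ r s t, D (.eq r s) → D (.eq s t) → D (.eq r t)
  mul_congr : ∀ s s' t t', D (.eq s s') → D (.eq t t') → D (.eq (.mul s t) (.mul s' t'))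
  inv_congr : ∀ t t', D (.eq t t') → D (.eq (.inv t) (.inv t'))
  eq_or_ne : ∀ s t, D (.eq s s) → D (.eq t t) → D (.eq s t) ∨ D (.ne s t)
  not_eq : ∀ s t, D (.ne s t) → D (.eq s t) → False
  of_ne : ∀ s t, D (.ne s t) → D (.eq s s) ∧ D (.eq t t)
  exists_var : ∀ t, D (.eq t t) → ∃ b, D (.eq (.var b) t)
  var_inj : ∀ a b, D (.eq (.var a) (.var b)) → a = b

theorem QFFormula.toNat_mod_four_lt_two (φ : QFFormula) : φ.toNat % 4 < 2 ↔ φ.IsLiteral := by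
  cases φ <;> simp [QFFormula.toNat, QFFormula.IsLiteral]

theorem NatStructure.isDiagram (B : NatStructure) : IsDiagram B.Sat := by
  refine ⟨fun φ h => φ.toNat_mod_four_lt_two.2 ((B.sat_iff φ).1 h).1, ?_, ?_, ?_, ?_, ?_, ?_, ?_,
    ?_, ?_, ?_, ?_, ?_⟩
  all_goals
    simp only [sat_eq_iff, sat_ne_iff, GTerm.vars, GTerm.value, Set.union_subset_iff,
      Set.singleton_subset_iff, Set.empty_subset, and_self, and_true, ne_eq]
  · exact fun s t h => h
  · exact fun t h => h
  · exact fun s t h => ⟨h.1.symm, h.2.symm⟩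
  · exact fun r s t h h' => ⟨⟨h.1.1, h'.1.2⟩, h.2.trans h'.2⟩
  · exact fun s s' t t' h h' => ⟨⟨⟨h.1.1, h'.1.1⟩, h.1.2, h'.1.2⟩, by rw [h.2, h'.2]⟩
  · exact fun t t' h => ⟨h.1, by rw [h.2]⟩
  · intro s t hs ht
    by_cases h : s.value B.assign = t.value B.assign <;> tauto
  · exact fun s t h h' => h.2 h'.2
  · exact fun s t h => h.1
  · exact fun t h => ⟨(t.value B.assign : B.carrier), ⟨⟨Subtype.coe_prop _, h⟩, B.assign_coe _⟩⟩
  · rintro a b ⟨⟨ha, hb⟩, h⟩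
    rw [B.assign_of_mem ha, B.assign_of_mem hb] at h
    exact congrArg Subtype.val h

theorem IsDiagram.refl_iff_vars {D : QFFormula → Prop} (h : IsDiagram D) (t : GTerm) :
    D (.eq t t) ↔ t.vars ⊆ {b | D (.eq (.var b) (.var b))} := by
  induction t with
  | one => exact iff_of_true h.one (by simp [GTerm.vars])
  | var n => simp [GTerm.vars]
  | inv t ih => exact Iff.trans ⟨h.inv t, h.inv_congr t t⟩ ih
  | mul s t ihs iht =>
    rw [GTerm.vars, Set.union_subset_iff, ← ihs, ← iht]
    exact ⟨h.mul s t, fun h' => h.mul_congr _ _ _ _ h'.1 h'.2⟩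

theorem IsDiagram.left {D : QFFormula → Prop} (h : IsDiagram D) {s t : GTerm}
    (h' : D (.eq s t)) : D (.eq s s) := h.trans _ _ _ h' (h.symm _ _ h')

/-- By induction `D` equates each term with the constant naming its value. Distinct constants are
never equated, so equality of values is the same as equality according to `D`. -/
theorem IsDiagram.sat_iff {D : QFFormula → Prop} (h : IsDiagram D) {B : NatStructure}
    (hC : B.carrier = {b | D (.eq (.var b) (.var b))})
    (hmul : ∀ a b : B.carrier, D (.eq (.var (a * b : B.carrier)) (.mul (.var a) (.var b))))
    (hinv : ∀ a : B.carrier, D (.eq (.var (a⁻¹ : B.carrier)) (.inv (.var a))))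
    (hone : D (.eq (.var (1 : B.carrier)) .one)) (φ : QFFormula) : B.Sat φ ↔ D φ := by
  have hrefl : ∀ t, D (.eq t t) ↔ t.vars ⊆ B.carrier := fun t => hC ▸ h.refl_iff_vars t
  have hval : ∀ t : GTerm, t.vars ⊆ B.carrier →
      D (.eq (.var (t.value B.assign : B.carrier)) t) := by
    intro t ht
    induction t with
    | one => exact hone
    | var n =>
      rw [GTerm.value, B.assign_of_mem (by simpa [GTerm.vars] using ht)]
      exact (hrefl _).2 ht
    | inv t ih => exact h.trans _ _ _ (hinv _) (h.inv_congr _ _ (ih ht))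
    | mul s t ihs iht =>
      rw [GTerm.vars, Set.union_subset_iff] at ht
      exact h.trans _ _ _ (hmul _ _) (h.mul_congr _ _ _ _ (ihs ht.1) (iht ht.2))
  have heq : ∀ s t : GTerm, s.vars ⊆ B.carrier → t.vars ⊆ B.carrier →
      (s.value B.assign = t.value B.assign ↔ D (.eq s t)) := by
    intro s t hs ht
    constructor
    · intro e
      have := hval s hs
      rw [e] at this
      exact h.trans _ _ _ (h.symm _ _ this) (hval t ht)
    · intro e
      exact Subtype.ext (h.var_inj _ _ (h.trans _ _ _ (hval s hs)
        (h.trans _ _ _ e (h.symm _ _ (hval t ht)))))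
  cases φ with
  | eq s t =>
    rw [B.sat_eq_iff]
    refine ⟨fun H => (heq s t H.1.1 H.1.2).1 H.2, fun H => ?_⟩
    have hs := (hrefl s).1 (h.left H)
    have ht := (hrefl t).1 (h.left (h.symm _ _ H))
    exact ⟨⟨hs, ht⟩, (heq s t hs ht).2 H⟩
  | ne s t =>
    rw [B.sat_ne_iff]
    constructor
    · rintro ⟨⟨hs, ht⟩, hne⟩
      exact (h.eq_or_ne s t ((hrefl s).2 hs) ((hrefl t).2 ht)).resolve_left
        fun e => hne ((heq s t hs ht).2 e)
    · intro H
      have hs := (hrefl s).1 (h.of_ne s t H).1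
      have ht := (hrefl t).1 (h.of_ne s t H).2
      exact ⟨⟨hs, ht⟩, fun e => h.not_eq s t H ((heq s t hs ht).1 e)⟩
  | conj φ ψ =>
    refine iff_of_false (fun H => ((B.sat_iff _).1 H).1) fun H => ?_
    exact (QFFormula.toNat_mod_four_lt_two _).1 (h.literal _ H)
  | disj φ ψ =>
    refine iff_of_false (fun H => ((B.sat_iff _).1 H).1) fun H => ?_
    exact (QFFormula.toNat_mod_four_lt_two _).1 (h.literal _ H)

/-- The universe consists of the `b` with `b = b` in `D`; the operations pick the constant that `D`
equates with the corresponding term. -/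
theorem IsDiagram.exists_structure {D : QFFormula → Prop} (h : IsDiagram D) :
    ∃ B : NatStructure, ∀ φ, B.Sat φ ↔ D φ := by
  choose r hr using h.exists_var
  let C : Set ℕ := {b | D (.eq (.var b) (.var b))}
  have hrC : ∀ t ht, r t ht ∈ C := fun t ht => h.left (hr t ht)
  have hmul : ∀ a b : C, D (.eq (.mul (.var a) (.var b)) (.mul (.var a) (.var b))) :=
    fun a b => h.mul_congr _ _ _ _ a.2 b.2
  have hinv : ∀ a : C, D (.eq (.inv (.var a)) (.inv (.var a))) := fun a => h.inv_congr _ _ a.2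
  exact ⟨⟨C, fun a b => ⟨_, hrC _ (hmul a b)⟩, fun a => ⟨_, hrC _ (hinv a)⟩, ⟨_, hrC _ h.one⟩⟩,
    h.sat_iff rfl (fun a b => hr _ (hmul a b)) (fun a => hr _ (hinv a)) (hr _ h.one)⟩

/-- The atomic diagram `D` says that its structure satisfies `IsRankOne`. -/
structure IsRankOneDiagram (D : QFFormula → Prop) (x : ℕ) (S : Set ℕ) : Prop where
  mem : D (.eq (.var x) (.var x))
  assoc : ∀ a b c, D (.eq (.var a) (.var a)) → D (.eq (.var b) (.var b)) →
    D (.eq (.var c) (.var c)) → D (.eq (.mul (.mul (.var a) (.var b)) (.var c))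
      (.mul (.var a) (.mul (.var b) (.var c))))
  one_mul : ∀ a, D (.eq (.var a) (.var a)) → D (.eq (.mul .one (.var a)) (.var a))
  inv_mul : ∀ a, D (.eq (.var a) (.var a)) → D (.eq (.mul (.inv (.var a)) (.var a)) .one)
  comm : ∀ a b, D (.eq (.var a) (.var a)) → D (.eq (.var b) (.var b)) →
    D (.eq (.mul (.var a) (.var b)) (.mul (.var b) (.var a)))
  ne_one : D (.eq (.var x) .one) → False
  torsionFree : ∀ k a, D (.eq (.var a) (.var a)) → D (.eq ((GTerm.var a).pow (k + 1)) .one) →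
    D (.eq (.var a) .one)
  rank : ∀ a, D (.eq (.var a) (.var a)) → ∃ k n,
    D (.eq ((GTerm.var a).pow (k + 1)) ((GTerm.var x).pow n)) ∨
    D (.eq (.mul ((GTerm.var a).pow (k + 1)) ((GTerm.var x).pow n)) .one)
  divides : ∀ k, (∃ a, D (.eq (.var a) (.var a)) ∧ D (.eq ((GTerm.var a).pow k) (.var x))) ↔ k ∈ S

theorem isRankOneDiagram_sat_iff (B : NatStructure) (x : ℕ) (S : Set ℕ) :
    IsRankOneDiagram B.Sat x S ↔ ∃ h : x ∈ B.carrier, IsRankOne B.carrier ⟨x, h⟩ S := by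
  have hmem : ∀ n : ℕ, B.Sat (.eq (.var n) (.var n)) ↔ n ∈ B.carrier := fun n => by
    simp [B.sat_self_iff, GTerm.vars]
  have heq : ∀ s t : GTerm, s.vars ⊆ B.carrier → t.vars ⊆ B.carrier →
      (B.Sat (.eq s t) ↔ s.value B.assign = t.value B.assign) := fun s t hs ht => by
    rw [B.sat_eq_iff, and_iff_right ⟨hs, ht⟩]
  have hv : ∀ b : B.carrier, (GTerm.var b).vars ⊆ B.carrier := fun b => by simp [GTerm.vars]
  have hone : GTerm.one.vars ⊆ B.carrier := by simp [GTerm.vars]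
  have hmul : ∀ s t : GTerm, s.vars ⊆ B.carrier → t.vars ⊆ B.carrier →
    (GTerm.mul s t).vars ⊆ B.carrier := fun s t => Set.union_subset
  have hval : ∀ b : B.carrier, (GTerm.var b).value B.assign = b := B.assign_coe
  have hm : ∀ s t : GTerm, (GTerm.mul s t).value B.assign
    = s.value B.assign * t.value B.assign := fun _ _ => rfl
  have hi : ∀ s : GTerm, (GTerm.inv s).value B.assign = (s.value B.assign)⁻¹ := fun _ => rfl
  have h1 : GTerm.one.value B.assign = 1 := rfl
  have hp := B.value_pow_var
  have hpv := B.vars_pow_var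
  have hlift : ∀ n, B.Sat (.eq (.var n) (.var n)) → ∃ b : B.carrier, n = b :=
    fun n hn => ⟨⟨n, (hmem n).1 hn⟩, rfl⟩
  have key : ∀ h : x ∈ B.carrier, IsRankOneDiagram B.Sat x S ↔
      IsRankOne B.carrier ⟨x, h⟩ S := by
    intro h
    obtain ⟨x, rfl⟩ : ∃ y : B.carrier, x = y := ⟨⟨x, h⟩, rfl⟩
    have e1 : ∀ a b c : B.carrier, _ := fun a b c => heq
      (.mul (.mul (.var a) (.var b)) (.var c)) (.mul (.var a) (.mul (.var b) (.var c)))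
      (hmul _ _ (hmul _ _ (hv a) (hv b)) (hv c)) (hmul _ _ (hv a) (hmul _ _ (hv b) (hv c)))
    have e2 : ∀ a : B.carrier, _ := fun a => heq (.mul .one (.var a)) (.var a)
      (hmul _ _ hone (hv a)) (hv a)
    have e3 : ∀ a : B.carrier, _ := fun a => heq (.mul (.inv (.var a)) (.var a)) .one
      (hmul (.inv (.var a)) _ (hv a) (hv a)) hone
    have e4 : ∀ a b : B.carrier, _ := fun a b => heq (.mul (.var a) (.var b))
      (.mul (.var b) (.var a)) (hmul _ _ (hv a) (hv b)) (hmul _ _ (hv b) (hv a))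
    have e5 : ∀ a : B.carrier, _ := fun a => heq (.var a) .one (hv a) hone
    have e6 : ∀ k (a : B.carrier), _ := fun k a => heq ((GTerm.var a).pow k) .one (hpv k a) hone
    have e7 : ∀ k n (a b : B.carrier), _ := fun k n a b => heq ((GTerm.var a).pow k)
      ((GTerm.var b).pow n) (hpv k a) (hpv n b)
    have e8 : ∀ k n (a b : B.carrier), _ := fun k n a b => heq (.mul ((GTerm.var a).pow k)
      ((GTerm.var b).pow n)) .one (hmul _ _ (hpv k a) (hpv n b)) hone
    have e9 : ∀ k (a b : B.carrier), _ := fun k a b => heq ((GTerm.var a).pow k) (.var b)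
      (hpv k a) (hv b)
    simp only [hval, hm, hi, h1, hp] at e1 e2 e3 e4 e5 e6 e7 e8 e9
    constructor
    · intro H
      refine ⟨fun a b c => (e1 a b c).1 (H.assoc _ _ _ ((hmem _).2 a.2) ((hmem _).2 b.2)
        ((hmem _).2 c.2)), fun a => (e2 a).1 (H.one_mul _ ((hmem _).2 a.2)),
        fun a => (e3 a).1 (H.inv_mul _ ((hmem _).2 a.2)),
        fun a b => (e4 a b).1 (H.comm _ _ ((hmem _).2 a.2) ((hmem _).2 b.2)),
        fun e => H.ne_one ((e5 x).2 e), fun k a e => (e5 a).1 (H.torsionFree k _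
        ((hmem _).2 a.2) ((e6 _ a).2 e)), fun a => ?_, fun k => ?_⟩
      · obtain ⟨k, n, h'⟩ := H.rank _ ((hmem _).2 a.2)
        exact ⟨k, n, h'.imp (e7 (k + 1) n a x).1 (e8 (k + 1) n a x).1⟩
      · rw [← H.divides k]
        constructor
        · rintro ⟨a, ha⟩
          exact ⟨a, (hmem _).2 a.2, (e9 k a x).2 ha⟩
        · rintro ⟨a, ha, h'⟩
          obtain ⟨a, rfl⟩ := hlift a ha
          exact ⟨a, (e9 k a x).1 h'⟩
    · intro H
      refine ⟨(hmem _).2 h, fun a b c ha hb hc => ?_, fun a ha => ?_, fun a ha => ?_,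
        fun a b ha hb => ?_, fun e => H.ne_one ((e5 x).1 e), fun k a ha e => ?_, fun a ha => ?_,
        fun k => ?_⟩
      · obtain ⟨a, rfl⟩ := hlift a ha
        obtain ⟨b, rfl⟩ := hlift b hb
        obtain ⟨c, rfl⟩ := hlift c hc
        exact (e1 a b c).2 (H.assoc _ _ _)
      · obtain ⟨a, rfl⟩ := hlift a ha
        exact (e2 a).2 (H.one_mul _)
      · obtain ⟨a, rfl⟩ := hlift a ha
        exact (e3 a).2 (H.inv_mul _)
      · obtain ⟨a, rfl⟩ := hlift a ha
        obtain ⟨b, rfl⟩ := hlift b hb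
        exact (e4 a b).2 (H.comm _ _)
      · obtain ⟨a, rfl⟩ := hlift a ha
        exact (e5 a).2 (H.torsionFree k _ ((e6 _ a).1 e))
      · obtain ⟨a, rfl⟩ := hlift a ha
        obtain ⟨k, n, h'⟩ := H.rank a
        exact ⟨k, n, h'.imp (e7 (k + 1) n a x).2 (e8 (k + 1) n a x).2⟩
      · rw [← H.divides k]
        constructor
        · rintro ⟨a, ha, h'⟩
          obtain ⟨a, rfl⟩ := hlift a ha
          exact ⟨a, (e9 k a x).1 h'⟩
        · rintro ⟨a, ha⟩
          exact ⟨a, (hmem _).2 a.2, (e9 k a x).2 ha⟩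
  exact ⟨fun H => ⟨(hmem x).1 H.mem, (key _).1 H⟩, fun ⟨h, H⟩ => (key h).2 H⟩

/-! ## The index set is `Σ⁰₃` -/

section IndexSet

/-- `φ` belongs to the set with index `e`. -/
def Accepts (e : ℕ) (φ : QFFormula) : Prop := 1 ∈ phi e φ.toNat

theorem sig1_accepts {α : Type} [Primcodable α] {f : α → ℕ} {g : α → QFFormula}
    (hf : Computable f) (hg : Computable g) : Sig1 fun a => Accepts (f a) (g a) :=
  sig1_phi.comp (f := fun a => (f a, Encodable.encode (g a), 1)) (by fun_prop)

/-- Acceptance is `Σ⁰₁`, and every closure property is a universally quantified implication from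
acceptances to a `Σ⁰₁` statement. -/
theorem pi2_isDiagram : Pi2 fun e => IsDiagram (Accepts e) := by
  have h : Pi2 fun e => (∀ φ : QFFormula, Accepts e φ → Encodable.encode φ % 4 < 2) ∧
      Accepts e (.eq .one .one) ∧
      (∀ s t : GTerm, Accepts e (.eq (.mul s t) (.mul s t)) →
        Accepts e (.eq s s) ∧ Accepts e (.eq t t)) ∧
      (∀ t : GTerm, Accepts e (.eq (.inv t) (.inv t)) → Accepts e (.eq t t)) ∧
      (∀ s t : GTerm, Accepts e (.eq s t) → Accepts e (.eq t s)) ∧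
      (∀ r s t : GTerm, Accepts e (.eq r s) → Accepts e (.eq s t) → Accepts e (.eq r t)) ∧
      (∀ s s' t t' : GTerm, Accepts e (.eq s s') → Accepts e (.eq t t') →
        Accepts e (.eq (.mul s t) (.mul s' t'))) ∧
      (∀ t t' : GTerm, Accepts e (.eq t t') → Accepts e (.eq (.inv t) (.inv t'))) ∧
      (∀ s t : GTerm, Accepts e (.eq s s) → Accepts e (.eq t t) →
        Accepts e (.eq s t) ∨ Accepts e (.ne s t)) ∧
      (∀ s t : GTerm, Accepts e (.ne s t) → Accepts e (.eq s t) → False) ∧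
      (∀ s t : GTerm, Accepts e (.ne s t) → Accepts e (.eq s s) ∧ Accepts e (.eq t t)) ∧
      (∀ t : GTerm, Accepts e (.eq t t) → ∃ b : ℕ, Accepts e (.eq (.var b) t)) ∧
      (∀ a b : ℕ, Accepts e (.eq (.var a) (.var b)) → a = b) := by
    repeat' first
      | refine Pi2.and ?_ ?_
      | refine Pi2.all ?_
      | refine Pi2.imp ?_ ?_
      | refine Pi2.iff ?_ ?_
      | refine Sig1.pi2 ?_
      | refine sig1_accepts ?_ ?_
      | refine Sig1.or ?_ ?_
      | refine Sig1.and ?_ ?_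
      | refine Sig1.ex ?_
      | refine ComputablePred.sig1 ?_
      | fun_prop
  exact h.of_eq fun e => ⟨fun ⟨h1, h2, h3, h4, h5, h6, h7, h8, h9, h10, h11, h12, h13⟩ =>
    ⟨h1, h2, h3, h4, h5, h6, h7, h8, h9, h10, h11, h12, h13⟩,
    fun ⟨h1, h2, h3, h4, h5, h6, h7, h8, h9, h10, h11, h12, h13⟩ =>
    ⟨h1, h2, h3, h4, h5, h6, h7, h8, h9, h10, h11, h12, h13⟩⟩

/-- The critical clause is the one on divisors: an equivalence of two `Σ⁰₁` statements is `Π⁰₂`, so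
it suffices that `S` is c.e. -/
theorem pi2_isRankOneDiagram {S : Set ℕ} (hS : Sig1 fun k => k ∈ S) :
    Pi2 fun q : ℕ × ℕ => IsRankOneDiagram (Accepts q.1) q.2 S := by
  have h : Pi2 fun q : ℕ × ℕ => Accepts q.1 (.eq (.var q.2) (.var q.2)) ∧
      (∀ a b c : ℕ, Accepts q.1 (.eq (.var a) (.var a)) → Accepts q.1 (.eq (.var b) (.var b)) →
        Accepts q.1 (.eq (.var c) (.var c)) →
        Accepts q.1 (.eq (.mul (.mul (.var a) (.var b)) (.var c))
          (.mul (.var a) (.mul (.var b) (.var c))))) ∧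
      (∀ a : ℕ, Accepts q.1 (.eq (.var a) (.var a)) →
        Accepts q.1 (.eq (.mul .one (.var a)) (.var a))) ∧
      (∀ a : ℕ, Accepts q.1 (.eq (.var a) (.var a)) →
        Accepts q.1 (.eq (.mul (.inv (.var a)) (.var a)) .one)) ∧
      (∀ a b : ℕ, Accepts q.1 (.eq (.var a) (.var a)) → Accepts q.1 (.eq (.var b) (.var b)) →
        Accepts q.1 (.eq (.mul (.var a) (.var b)) (.mul (.var b) (.var a)))) ∧
      (Accepts q.1 (.eq (.var q.2) .one) → False) ∧
      (∀ k a : ℕ, Accepts q.1 (.eq (.var a) (.var a)) →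
        Accepts q.1 (.eq ((GTerm.var a).pow (k + 1)) .one) → Accepts q.1 (.eq (.var a) .one)) ∧
      (∀ a : ℕ, Accepts q.1 (.eq (.var a) (.var a)) → ∃ k n : ℕ,
        Accepts q.1 (.eq ((GTerm.var a).pow (k + 1)) ((GTerm.var q.2).pow n)) ∨
        Accepts q.1 (.eq (.mul ((GTerm.var a).pow (k + 1)) ((GTerm.var q.2).pow n)) .one)) ∧
      (∀ k : ℕ, (∃ a : ℕ, Accepts q.1 (.eq (.var a) (.var a)) ∧
        Accepts q.1 (.eq ((GTerm.var a).pow k) (.var q.2))) ↔ k ∈ S) := by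
    repeat' first
      | refine Pi2.and ?_ ?_
      | refine Pi2.all ?_
      | refine Pi2.imp ?_ ?_
      | refine Pi2.iff ?_ ?_
      | refine Sig1.pi2 ?_
      | refine sig1_accepts ?_ ?_
      | refine Sig1.or ?_ ?_
      | refine Sig1.and ?_ ?_
      | refine Sig1.ex ?_
      | exact hS.comp (f := fun x : (ℕ × ℕ) × ℕ => x.2) (by fun_prop)
      | refine ComputablePred.sig1 ?_
      | fun_prop
  exact h.of_eq fun e => ⟨fun ⟨h1, h2, h3, h4, h5, h6, h7, h8, h9⟩ =>
    ⟨h1, h2, h3, h4, h5, h6, h7, h8, h9⟩, fun ⟨h1, h2, h3, h4, h5, h6, h7, h8, h9⟩ =>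
    ⟨h1, h2, h3, h4, h5, h6, h7, h8, h9⟩⟩

theorem isSigma03_indexSet {G : AddSubgroup ℚ}
    (hG : IsComputablyPresented (Multiplicative G)) {u : ℚ} (huG : u ∈ G) (hu : u ≠ 0) :
    IsSigma03 (indexSet (Multiplicative G)) := by
  classical
  have hS : Sig1 fun k => k ∈ {k | DividesIn G k u} := sig1_dividesIn hG huG hu
  -- The outer existential quantifier ranges over names `x` of an element playing the role of `u`.
  -- The first conjunct makes `phi e` total with values `0` and `1`, since `Accepts` only sees the
  -- value `1`.
  refine Pi2.isSigma03 (P := fun e x => (∀ n, 0 ∈ phi e n ∨ 1 ∈ phi e n) ∧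
    IsDiagram (Accepts e) ∧ IsRankOneDiagram (Accepts e) x {k | DividesIn G k u}) ?_ fun e => ?_
  · refine Pi2.and (Pi2.all (Sig1.pi2 ?_)) (Pi2.and (pi2_isDiagram.comp (by fun_prop))
      (pi2_isRankOneDiagram hS))
    refine Sig1.or ?_ ?_
    · exact sig1_phi.comp (f := fun x : (ℕ × ℕ) × ℕ => (x.1.1, x.2, 0)) (by fun_prop)
    · exact sig1_phi.comp (f := fun x : (ℕ × ℕ) × ℕ => (x.1.1, x.2, 1)) (by fun_prop)
  · constructor
    · rintro ⟨B, hB, he⟩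
      have hSat : Accepts e = B.Sat := by
        funext φ
        apply propext
        rw [Accepts, he, Part.mem_some_iff, NatStructure.Sat]
        split_ifs with h <;> simp [h]
      obtain ⟨x, hx⟩ := (structIso_iff_isRankOne huG hu).1 hB
      refine ⟨x, fun n => ?_, hSat ▸ B.isDiagram, hSat ▸
        (isRankOneDiagram_sat_iff B x _).2 ⟨x.2, hx⟩⟩
      rw [he]
      split_ifs <;> simp
    · rintro ⟨x, htot, hD, hx⟩
      obtain ⟨B, hB⟩ := hD.exists_structure
      have hSat : Accepts e = B.Sat := funext fun φ => propext (hB φ).symm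
      rw [hSat, isRankOneDiagram_sat_iff] at hx
      obtain ⟨h, hx⟩ := hx
      refine ⟨B, hx.structIso huG hu, fun n => Part.eq_some_iff.2 ?_⟩
      have hn : 1 ∈ phi e n ↔ n ∈ B.atomicDiagram := by
        rw [B.mem_atomicDiagram, ← hSat, Accepts, QFFormula.toNat_ofNat]
      split_ifs with h'
      · exact hn.2 h'
      · exact (htot n).resolve_right (mt hn.1 h')

end IndexSet

end InfGroup

theorem mainTheorem3 (G : AddSubgroup ℚ)
    (hG : InfGroup.IsComputablyPresented (Multiplicative G))
    (u : ℚ) (huG : u ∈ G) (hu : u ≠ 0)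
    (hzero : (InfGroup.primesZero G u).Finite)
    (hinf : (InfGroup.primesInf G u).Finite)
    (hfin : (InfGroup.primesFin G u).Infinite) :
    (∃ φ : InfGroup.InfFormula, InfGroup.IsComputableSigma 3 φ ∧
      InfGroup.IsScottSentence φ (Multiplicative G)) ∧
    InfGroup.IsMCompleteSigma03 (InfGroup.indexSet (Multiplicative G)) :=
  ⟨InfGroup.exists_scottSentence hG huG hu, InfGroup.isSigma03_indexSet hG huG hu,
    fun _ hT => InfGroup.manyOneReducible_indexSet hG huG hu hzero hinf hT⟩
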